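/- **Setting.** Let $n\ge 1$ and $\ell\ge 2$ be integers and let $G$ be a subgroup of the symmetric group $S_n$ of $[n]=\{1,\dots,n\}$. Write $\deg(\sigma)$ for the number of points moved by $\sigma$, and $\mathrm{supp}(\sigma)$ for the set of these points. The group $G$ is *$\ell$-local* if for every $\sigma\in G$ and all $i,j\in[n]$ with $\sigma(i)=j$ there is $\tau\in G$ with $\mathrm{supp}(\tau)\subset\mathrm{supp}(\sigma)$, $\deg(\tau)\le\ell$ and $\tau(i)=j$. For $j\in[n]$ let $G_j=\{\sigma\in G:\sigma(k)=k\text{ for all }k>j\}$ and $O_j=\{\sigma(j):\sigma\in G_j\}$, and let $K_n=\#\{j\in\{2,\dots,n\}:O_j\ne\{j\}\}$. An *$\ell$-local base* of $G$ is a family $\mathcal T=(t_{i,j})_{2\le j\le n,\ i\in O_j}$ in $G$ with $t_{j,j}=\mathrm{id}$ and, for $i\neq j$, $t_{i,j}\in G_j$, $t_{i,j}(i)=j$ and $\deg(t_{i,j})\le \ell$. Let $U_{\mathcal T}:O_2\times\cdots\times O_n\to G$, $U_{\mathcal T}(i_2,\dots,i_n)=t_{i_2,2}t_{i_3,3}\cdots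 t_{i_n,n}$ (composition of maps), and let $\mathcal M_{\mathcal T}$ be the set of all push-forwards by $U_{\mathcal T}$ of product probability measures $\hat\nu_2\otimes\cdots\otimes\hat\nu_n$ with $\hat\nu_j\in\mathcal P(O_j)$. For $\sigma,\tau\in G$ let $d_H(\sigma,\tau)=\#\{i:\sigma(i)\ne\tau(i)\}$ and let $d_T(\sigma,\tau)$ be the least $k$ such that $\sigma t_1\cdots t_k=\tau$ for some $t_1,\dots,t_k\in G$ of degree at most $\ell$. Let $\Pi(\nu_1,\nu_2)$ be the set of probability measures on $G\times G$ with marginals $\nu_1,\nu_2$, and for $\pi\in\Pi(\nu_1,\nu_2)$ write $\pi(\sigma,\tau)=\nu_1(\sigma)p_\sigma(\tau)$ with $p_\sigma$ a probability measure on $G$. For $d\in\{d_H,d_T\}$ put $$W_1(\nu_1,\nu_2)=\inf_{\pi\in\Pi(\nu_1,\nu_2)}\iint d\,d\pi,\qquad \widetilde T_2(\nu_2|\nu_1)=\inf_{\pi\in\Pi(\nu_1,\nu_2)}\int\Big(\int d(\sigma,\tau)\,dp_\sigma(\tau)\Big)^2d\nu_1(\sigma),$$ $$\widehat T_2(\nu_2|\nu_1)=\inf_{\pi\in\Pi(\nu_1,\nu_2)}\int\sum_{i=1}^n\Big(\int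 \mathbf 1_{\sigma(i)\ne\tau(i)}\,dp_\sigma(\tau)\Big)^2d\nu_1(\sigma).$$ Let $H(\nu|\mu)=\int\log\frac{d\nu}{d\mu}\,d\nu$ if $\nu\ll\mu$ and $H(\nu|\mu)=+\infty$ otherwise. Consider the inequalities, for all probability measures $\nu_1,\nu_2$ on $G$, $$\frac{2}{c(\ell)^2}W_1^2(\nu_1,\nu_2)\le K_n\Big(\sqrt{H(\nu_1|\mu)}+\sqrt{H(\nu_2|\mu)}\Big)^2,\tag{1}$$ $$\frac{1}{2c(\ell)^2}\widetilde T_2(\nu_2|\nu_1)\le K_n\Big(\sqrt{H(\nu_1|\mu)}+\sqrt{H(\nu_2|\mu)}\Big)^2,\tag{2}$$ $$\frac{1}{2c(\ell)^2}\widehat T_2(\nu_2|\nu_1)\le \Big(\sqrt{H(\nu_1|\mu)}+\sqrt{H(\nu_2|\mu)}\Big)^2.\tag{3}$$ **Theorem.** (a) If $\mathcal T$ is an $\ell$-local base of $G$ and $\mu\in\mathcal M_{\mathcal T}$, then (1) and (2) hold with $c(\ell)=\min(2\ell-1,n)$ if $d=d_H$ and with $c(\ell)=2$ if $d=d_T$.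 If $G$ is $\ell$-local and $\mu$ is the uniform law on $G$, then (1) and (2) hold with $c(\ell)=\ell$ if $d=d_H$ and with $c(\ell)=1$ if $d=d_T$. (b) If $G$ is $\ell$-local and $\mu$ is the uniform law on $G$, then (3) holds with $c(\ell)^2=2(\ell-1)^2+2$. If $\mathcal T$ is an $\ell$-local base of $G$, $\mu\in\mathcal M_{\mathcal T}$, $G$ is a normal subgroup of $S_n$, and $\mu(\sigma)=\mu(\sigma^{-1})$ and $\mu(\sigma)=\mu(t^{-1}\sigma t)$ for all $\sigma\in G$, $t\in S_n$, then (3) holds with $c(\ell)^2=8(\ell-1)^2+2$. -/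

import Mathlib

open MeasureTheory ProbabilityTheory
open scoped ENNReal

noncomputable section

namespace PermTransport

/-- Every subset of a finite set of permutations is measurable. -/
instance permMeasurableSpace (n : ℕ) : MeasurableSpace (Equiv.Perm (Fin n)) := ⊤

instance permDiscreteMeasurableSpace (n : ℕ) :
    DiscreteMeasurableSpace (Equiv.Perm (Fin n)) := ⟨fun _ => trivial⟩

variable {n : ℕ}

/-- The degree of a permutation: the number of points that it moves. -/
def deg (σ : Equiv.Perm (Fin n)) : ℕ := σ.support.card

/-- `ℓ`-local groups of permutations. -/
def IsLocal (ℓ : ℕ) (G : Subgroup (Equiv.Perm (Fin n))) : Prop :=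
  ∀ σ ∈ G, ∀ i j : Fin n, σ i = j →
    ∃ τ ∈ G, τ.support ⊆ σ.support ∧ deg τ ≤ ℓ ∧ τ i = j

/-- The subgroup `G_j` of the elements of `G` that fix every `k > j`. -/
def tailStab (G : Subgroup (Equiv.Perm (Fin n))) (j : Fin n) :
    Subgroup (Equiv.Perm (Fin n)) where
  carrier := {σ | σ ∈ G ∧ ∀ k, j < k → σ k = k}
  one_mem' := ⟨G.one_mem, fun _ _ => rfl⟩
  mul_mem' := by
    rintro a b ⟨ha, ha'⟩ ⟨hb, hb'⟩
    refine ⟨G.mul_mem ha hb, fun k hk => ?_⟩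
    rw [Equiv.Perm.mul_apply, hb' k hk, ha' k hk]
  inv_mem' := by
    rintro a ⟨ha, ha'⟩
    refine ⟨G.inv_mem ha, fun k hk => ?_⟩
    rw [Equiv.Perm.inv_eq_iff_eq, ha' k hk]

/-- The orbit `O_j` of `j` under `G_j`. -/
def orb (G : Subgroup (Equiv.Perm (Fin n))) (j : Fin n) : Set (Fin n) :=
  {i | ∃ σ ∈ tailStab G j, σ j = i}

/-- `K_n`, the number of `j` with `O_j ≠ {j}`. (The first point never counts: `G_j` is trivial
for the first `j`.) -/
def numNontrivialOrb (G : Subgroup (Equiv.Perm (Fin n))) : ℕ :=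
  Set.ncard {j : Fin n | orb G j ≠ {j}}

/-- `t` is an `ℓ`-local base of `G`; here `t j i` is `t_{i,j}`, with `i ∈ O_j`. The family is also
indexed by the first point `j` of `Fin n`, for which `O_j = {j}` and `t j j = 1` is forced, so that
this index adds nothing. -/
def IsLocalBase (ℓ : ℕ) (G : Subgroup (Equiv.Perm (Fin n)))
    (t : (j : Fin n) → orb G j → G) : Prop :=
  ∀ (j : Fin n) (i : orb G j),
    ((i : Fin n) = j → t j i = 1) ∧
    ((i : Fin n) ≠ j →
      (t j i : Equiv.Perm (Fin n)) ∈ tailStab G j ∧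
      (t j i : Equiv.Perm (Fin n)) i = j ∧
      deg (t j i : Equiv.Perm (Fin n)) ≤ ℓ)

/-- The map `(i_2, …, i_n) ↦ t_{i_2,2} t_{i_3,3} ⋯ t_{i_n,n}`
(the factor of the first point of `Fin n` is the identity for a local base). -/
def baseMap {G : Subgroup (Equiv.Perm (Fin n))} (t : (j : Fin n) → orb G j → G)
    (i : (j : Fin n) → orb G j) : G :=
  (List.ofFn fun j => t j (i j)).prod

/-- The class of measures on `G` that are push-forwards under `baseMap t` of products of
probability measures on the sets `O_j`. -/
def measureClass {G : Subgroup (Equiv.Perm (Fin n))} (t : (j : Fin n) → orb G j → G) :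
    Set (Measure G) :=
  {μ | ∃ ν : (j : Fin n) → Measure (orb G j),
    (∀ j, IsProbabilityMeasure (ν j)) ∧ μ = (Measure.pi ν).map (baseMap t)}

/-- The uniform law on `G`. -/
def uniformLaw (G : Subgroup (Equiv.Perm (Fin n))) : Measure G :=
  uniformOn (Set.univ : Set G)

/-- The Hamming distance on `G`. -/
def dH (G : Subgroup (Equiv.Perm (Fin n))) (σ τ : G) : ℝ≥0∞ :=
  (hammingDist (σ : Equiv.Perm (Fin n)) (τ : Equiv.Perm (Fin n)) : ℕ)

/-- The distance `d_T`: the least number of factors `t_1, …, t_k` in `G`, of degree at most `ℓ`,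
with `σ t_1 ⋯ t_k = τ` (it would be `∞` if there were none). -/
def dT (ℓ : ℕ) (G : Subgroup (Equiv.Perm (Fin n))) (σ τ : G) : ℝ≥0∞ :=
  ⨅ (l : List G) (_ : ∀ t ∈ l, deg (t : Equiv.Perm (Fin n)) ≤ ℓ) (_ : σ * l.prod = τ),
    (l.length : ℝ≥0∞)

variable {G : Subgroup (Equiv.Perm (Fin n))}

/-- Couplings: measures on `G × G` with first marginal `ν₁` and second marginal `ν₂`. -/
def couplings (ν₁ ν₂ : Measure G) : Set (Measure (G × G)) :=
  {π | π.fst = ν₁ ∧ π.snd = ν₂}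

/-- The Wasserstein distance `W_1(ν₁, ν₂)` for the cost `d`. -/
def W₁ (d : G → G → ℝ≥0∞) (ν₁ ν₂ : Measure G) : ℝ≥0∞ :=
  ⨅ π ∈ couplings ν₁ ν₂, ∫⁻ x, d x.1 x.2 ∂π

/-- The weak transport cost `T̃_2(ν₂ | ν₁)` for the cost `d`. The infimum runs over the couplings
`π` and their disintegrations `π(σ, τ) = ν₁(σ) p_σ(τ)`. -/
def Ttilde (d : G → G → ℝ≥0∞) (ν₂ ν₁ : Measure G) : ℝ≥0∞ :=
  ⨅ (π ∈ couplings ν₁ ν₂) (p : Kernel G G) (_ : IsMarkovKernel p) (_ : π = ν₁ ⊗ₘ p),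
    ∫⁻ σ, (∫⁻ τ, d σ τ ∂(p σ)) ^ 2 ∂ν₁

/-- The weak transport cost `T̂_2(ν₂ | ν₁)`:
the integral `∫ 1_{σ(i) ≠ τ(i)} dp_σ(τ)` is the mass that `p_σ` gives to `{τ | σ(i) ≠ τ(i)}`. -/
def That (ν₂ ν₁ : Measure G) : ℝ≥0∞ :=
  ⨅ (π ∈ couplings ν₁ ν₂) (p : Kernel G G) (_ : IsMarkovKernel p) (_ : π = ν₁ ⊗ₘ p),
    ∫⁻ σ, ∑ i : Fin n,
      (p σ {τ : G | (σ : Equiv.Perm (Fin n)) i ≠ (τ : Equiv.Perm (Fin n)) i}) ^ 2 ∂ν₁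

/-- `(√H(ν₁|μ) + √H(ν₂|μ))²`, where `H(ν|μ)` is the relative entropy, with value `∞` if `ν` is not
absolutely continuous with respect to `μ`. -/
def entropyBound (μ ν₁ ν₂ : Measure G) : ℝ≥0∞ :=
  (InformationTheory.klDiv ν₁ μ ^ (1 / 2 : ℝ) + InformationTheory.klDiv ν₂ μ ^ (1 / 2 : ℝ)) ^ 2

/-- `(2 / c²) W_1² ≤ K_n (√H(ν₁|μ) + √H(ν₂|μ))²` for all probability measures `ν₁, ν₂` on `G`. -/
def W₁EntropyIneq (d : G → G → ℝ≥0∞) (c : ℕ) (μ : Measure G) : Prop :=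
  ∀ ν₁ ν₂ : Measure G, IsProbabilityMeasure ν₁ → IsProbabilityMeasure ν₂ →
    2 / (c : ℝ≥0∞) ^ 2 * W₁ d ν₁ ν₂ ^ 2 ≤ (numNontrivialOrb G : ℝ≥0∞) * entropyBound μ ν₁ ν₂

/-- `(1 / (2c²)) T̃_2(ν₂|ν₁) ≤ K_n (√H(ν₁|μ) + √H(ν₂|μ))²` for all probability measures
`ν₁, ν₂` on `G`. -/
def TtildeEntropyIneq (d : G → G → ℝ≥0∞) (c : ℕ) (μ : Measure G) : Prop :=
  ∀ ν₁ ν₂ : Measure G, IsProbabilityMeasure ν₁ → IsProbabilityMeasure ν₂ →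
    1 / (2 * (c : ℝ≥0∞) ^ 2) * Ttilde d ν₂ ν₁ ≤
      (numNontrivialOrb G : ℝ≥0∞) * entropyBound μ ν₁ ν₂

/-- `(1 / (2 c²)) T̂_2(ν₂|ν₁) ≤ (√H(ν₁|μ) + √H(ν₂|μ))²` for all probability measures
`ν₁, ν₂` on `G`; the argument `csq` is `c²`. -/
def ThatEntropyIneq (csq : ℕ) (μ : Measure G) : Prop :=
  ∀ ν₁ ν₂ : Measure G, IsProbabilityMeasure ν₁ → IsProbabilityMeasure ν₂ →
    1 / (2 * (csq : ℝ≥0∞)) * That ν₂ ν₁ ≤ entropyBound μ ν₁ ν₂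

end PermTransport

end

open InformationTheory

set_option linter.unusedSectionVars false

noncomputable section

namespace PermTransport

open Finset

/-! ### Scalar inequalities for `klFun`, behind Pinsker's and Marton's bounds. -/

section Scalar

/-! Fix `a`, `b > 0` with `1/a + 1/b = 1` and put `E = a H(ν₁|μ) + b H(ν₂|μ)`. The infimum of `E`
over such exponents is `(√H(ν₁|μ) + √H(ν₂|μ))²` (`le_mul_sqrt_add_sqrt_sq`), so it suffices to bound
each cost by a multiple of `E`. This quantity is linear in the entropies, hence splits by the chain
rule.

A permutation is revealed by the positions of its values, one value at a time. Once the positions of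
the values in `J` are fixed, the next label is the position of some `j`. The label laws of `ν₁` and
`ν₂` are coupled by moving as little mass as possible; Pinsker's and Marton's inequalities bound the
mean and the mean square of the moved mass by the label entropies (`exists_minimal_transport`). When
the label changes from `i` to `k`, the permutation is multiplied on the right by some `θ` carrying
the fibre over `i` to the fibre over `k` and, up to a constant, `μ` on one to `μ` on the other
(`Swap`). The relative entropy of the conditional law of `ν₁` is then unchanged, and the transport
continues inside the fibre over `k`. The label entropies pay for this step and the conditional
entropies for the later ones (`exists_label_transport`).

For `W₁` and `Ttilde` the values are revealed in decreasing order. A change of label costs at most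
`c`, and levels with trivial orbit move nothing. Jensen's inequality adds up the squares of the
masses moved at the different levels (`exists_transport_of_chain`); Cauchy–Schwarz over the
nontrivial levels produces `K_n`.

For `That` the moves must be counted point by point. A `θ` of degree at most `s + 1` moves at most
`s` points besides the revealed one, and these moves must be added to later moves of the same points
before squaring. The induction therefore carries a penalty `y`: the sum of `(move + y)²` is at most
`2 (∑ y)² + (4 s² + 4) E` (`exists_transport_penalized`). If the penalty is a mass `Y` at a single
value, that value is revealed next: if it moves with probability `A`, then `(A + Y)² ≤ 2 A² + 2 Y²`,
and the other moves become a penalty of total mass at most `s A` for the fibres, so the step costs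
`(2 + 2 s²) A²`. A general penalty is handled by choosing the pivot at random in proportion to it.
The new penalty lives on positions instead of values, so the induction passes to inverse
permutations. This is why `That` needs shifts for every pivot, both for `μ` and for its image under
inversion.

The shifts come from two sources. For the uniform law of a local group, `θ` is given by locality
applied to `σ₁⁻¹ σ₂` (`IsLocal.swap`). For a local base, exchanging one factor of `A t B` for `t'`
is right multiplication by `B⁻¹ t⁻¹ t' B`, of degree at most `2ℓ - 1` and a product of two elements
of degree at most `ℓ` (`IsLocalBase.swap`). Conjugation invariance carries these shifts from the
chain of the `G_j` to all pivots (`swap_of_conj_invariant`). -/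

lemma two_mul_sub_le_add_one_mul_log {x : ℝ} (hx : 1 ≤ x) :
    2 * (x - 1) ≤ (x + 1) * Real.log x := by
  have h := Real.le_log_one_add_of_nonneg (x := x - 1) (by linarith)
  rw [div_le_iff₀ (by linarith)] at h
  have e : 1 + (x - 1) = x := by ring
  rw [e] at h
  linarith

lemma add_one_mul_log_le_two_mul_sub {x : ℝ} (hx : 0 < x) (hx' : x ≤ 1) :
    (x + 1) * Real.log x ≤ 2 * (x - 1) := by
  have h := two_mul_sub_le_add_one_mul_log (x := x⁻¹) ((one_le_inv₀ hx).2 hx')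
  rw [Real.log_inv] at h
  have h2 := mul_le_mul_of_nonneg_left h hx.le
  have e1 : x * (2 * (x⁻¹ - 1)) = 2 * (1 - x) := by field_simp
  have e2 : x * ((x⁻¹ + 1) * -Real.log x) = -((x + 1) * Real.log x) := by field_simp; ring
  rw [e1, e2] at h2
  linarith

/-- The scalar inequality behind Pinsker's inequality. -/
lemma three_mul_sub_one_sq_le_klFun {x : ℝ} (hx : 0 ≤ x) :
    3 * (x - 1) ^ 2 ≤ (2 * x + 4) * klFun x := by
  -- The function `g` vanishes at `1`, and its derivative `4 ((y + 1) log y - 2 (y - 1))` has the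
  -- sign of `y - 1`.
  let g : ℝ → ℝ := fun x => (2 * x + 4) * klFun x - 3 * (x - 1) ^ 2
  have hc : Continuous g := by
    have := continuous_klFun
    fun_prop
  have hd : ∀ y, 0 < y → HasDerivAt g (4 * ((y + 1) * Real.log y - 2 * (y - 1))) y := by
    intro y hy
    have h1 := (((hasDerivAt_id y).const_mul 2).add_const 4).mul (hasDerivAt_klFun hy.ne')
    have h2 := ((((hasDerivAt_id y).sub_const 1).pow 2).const_mul 3)
    refine (h1.sub h2).congr_deriv ?_
    simp only [klFun_apply, id_eq]
    ring
  have g1 : g 1 = 0 := by simp [g, klFun_one]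
  suffices 0 ≤ g x by simp only [g] at this; linarith
  rcases le_total x 1 with h | h
  · have hanti : AntitoneOn g (Set.Icc 0 1) := by
      apply antitoneOn_of_deriv_nonpos (convex_Icc 0 1) hc.continuousOn
      · intro y hy
        rw [interior_Icc] at hy
        exact (hd y hy.1).differentiableAt.differentiableWithinAt
      · intro y hy
        rw [interior_Icc] at hy
        rw [(hd y hy.1).deriv]
        linarith [add_one_mul_log_le_two_mul_sub hy.1 hy.2.le]
    have := hanti ⟨hx, h⟩ ⟨zero_le_one, le_rfl⟩ h
    linarith
  · have hmono : MonotoneOn g (Set.Ici 1) := by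
      apply monotoneOn_of_deriv_nonneg (convex_Ici 1) hc.continuousOn
      · intro y hy
        rw [interior_Ici] at hy
        exact (hd y (zero_lt_one.trans hy)).differentiableAt.differentiableWithinAt
      · intro y hy
        rw [interior_Ici] at hy
        rw [(hd y (zero_lt_one.trans hy)).deriv]
        have : (1 : ℝ) ≤ y := le_of_lt hy
        linarith [two_mul_sub_le_add_one_mul_log this]
    have := hmono (Set.mem_Ici.2 le_rfl) h h
    linarith

lemma sub_one_sq_le_two_mul_self_mul_klFun {x : ℝ} (hx : 1 ≤ x) :
    (x - 1) ^ 2 ≤ 2 * x * klFun x := by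
  have h := two_mul_sub_le_add_one_mul_log hx
  rw [klFun_apply]
  have h1 : (x - 1) ^ 2 ≤ (x + 1) * (x * Real.log x + 1 - x) := by nlinarith
  have h2 := klFun_nonneg (x := x) (by linarith)
  rw [klFun_apply] at h2
  nlinarith

lemma one_sub_sq_le_two_mul_klFun {x : ℝ} (hx : 0 ≤ x) (hx' : x ≤ 1) :
    (1 - x) ^ 2 ≤ 2 * klFun x := by
  have h := three_mul_sub_one_sq_le_klFun hx
  have h2 := klFun_nonneg hx
  nlinarith

/-- Since `(a - 1) (b - 1) = 1`, the difference of the two sides is a nonnegative multiple of a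
square. This is where conjugate exponents are needed. -/
lemma add_sq_le_of_conj {a b : ℝ} (ha : 0 < a) (hb : 0 < b) (hab : 1 / a + 1 / b = 1) (x y : ℝ) :
    (x + y) ^ 2 ≤ a * x ^ 2 + b * y ^ 2 := by
  have hab' : a + b = a * b := by field_simp at hab; linarith
  have ha1 : (a - 1) * (b - 1) = 1 := by ring_nf; linarith
  have ha2 : 0 < a - 1 := by nlinarith
  have : a * x ^ 2 + b * y ^ 2 - (x + y) ^ 2 = (b - 1) * ((a - 1) * x - y) ^ 2 := by
    linear_combination (-x ^ 2 * (a - 1) + 2 * x * y) * ha1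
  have hb1 : 0 < b - 1 := by
    by_contra hcon
    nlinarith
  nlinarith [mul_nonneg hb1.le (sq_nonneg ((a - 1) * x - y))]

/-- Two-sided form of Marton's scalar inequality. -/
lemma posPart_sub_sq_le {a b : ℝ} (ha : 0 < a) (hb : 0 < b) (hab : 1 / a + 1 / b = 1)
    {x y : ℝ} (hx : 0 ≤ x) (hy : 0 ≤ y) :
    (max (x - y) 0) ^ 2 ≤ x * (2 * (a * klFun x + b * klFun y)) := by
  have hkx := klFun_nonneg hx
  have hky := klFun_nonneg hy
  have hab' : a + b = a * b := by field_simp at hab; linarith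
  have ha2 : 1 < a := by nlinarith
  have hb2 : 1 < b := by nlinarith
  rcases le_total x y with h | h
  · rw [max_eq_right (by linarith)]
    simp only [ne_eq, OfNat.ofNat_ne_zero, not_false_eq_true, zero_pow]
    positivity
  rw [max_eq_left (by linarith)]
  -- For `1 ≤ y` the entropy of `x` alone suffices, for `x ≤ 1` that of `y` alone; when `y ≤ 1 ≤ x`
  -- the difference is split at `1`.
  rcases le_total 1 y with h1 | h1
  · have := sub_one_sq_le_two_mul_self_mul_klFun (x := x) (by linarith)
    have h3 : (x - y) ^ 2 ≤ (x - 1) ^ 2 := by nlinarith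
    have h4 : x * klFun x ≤ a * (x * klFun x) := by nlinarith [mul_nonneg hx hkx]
    nlinarith [mul_nonneg hb.le (mul_nonneg hx hky)]
  have hK := one_sub_sq_le_two_mul_klFun hy h1
  rcases le_total x 1 with h2 | h2
  · have h3 : (x - y) ^ 2 ≤ x * (1 - y) ^ 2 := by
      have h5 : (x - y) ≤ x * (1 - y) := by nlinarith
      have h6 : x - y ≤ 1 - y := by linarith
      nlinarith [mul_le_mul h5 h6 (by linarith) (by nlinarith)]
    have h4 : x * klFun y ≤ b * (x * klFun y) := by nlinarith [mul_nonneg hx hky]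
    nlinarith [mul_nonneg ha.le (mul_nonneg hx hkx)]
  · have := sub_one_sq_le_two_mul_self_mul_klFun h2
    have h3 := add_sq_le_of_conj ha hb hab (x - 1) (1 - y)
    have h4 : (1 - y) ^ 2 ≤ x * (2 * klFun y) := by nlinarith
    have e : x - 1 + (1 - y) = x - y := by ring
    rw [e] at h3
    nlinarith

end Scalar

/-! ### Relative entropy of vectors, Pinsker's inequality and minimal transport. -/

section Finite

variable {α ι : Type*} [Fintype α] [Fintype ι] [DecidableEq ι]

/-- Probability vectors. -/
def IsProb (ν : α → ℝ) : Prop := (∀ x, 0 ≤ ν x) ∧ ∑ x, ν x = 1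

/-- The relative entropy of a probability vector `ν` with respect to the normalization of `μ`. -/
noncomputable def relEnt (ν μ : α → ℝ) : ℝ := ∑ x, ν x * Real.log (ν x / μ x) + Real.log (∑ x, μ x)

lemma IsProb.exists_ne_zero {ν : α → ℝ} (h : IsProb ν) : ∃ x, ν x ≠ 0 := by
  by_contra! hcon
  have := h.2
  simp [hcon] at this

lemma sum_pos_of_isProb {ν μ : α → ℝ} (hν : IsProb ν) (hμ : ∀ x, 0 ≤ μ x)
    (hac : ∀ x, ν x ≠ 0 → μ x ≠ 0) : 0 < ∑ x, μ x := by
  obtain ⟨x, hx⟩ := hν.exists_ne_zero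
  exact sum_pos' (fun i _ => hμ i) ⟨x, mem_univ _, (hμ x).lt_of_ne' (hac x hx)⟩

lemma relEnt_eq_sum_klFun {ν μ : α → ℝ} (hν : IsProb ν) (hμ : ∀ x, 0 ≤ μ x)
    (hac : ∀ x, ν x ≠ 0 → μ x ≠ 0) :
    relEnt ν μ = ∑ x, μ x / (∑ x, μ x) * klFun (ν x / (μ x / ∑ x, μ x)) := by
  have hs := sum_pos_of_isProb hν hμ hac
  set s := ∑ x, μ x with hs_def
  have key : ∀ x, μ x / s * klFun (ν x / (μ x / s)) =
      ν x * Real.log (ν x / μ x) + ν x * Real.log s + μ x / s - ν x := by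
    intro x
    by_cases hx : ν x = 0
    · simp [hx, klFun_zero]
    · have h1 := hac x hx
      have h2 : ν x / (μ x / s) = ν x / μ x * s := by field_simp
      rw [klFun_apply, h2, Real.log_mul (div_ne_zero hx h1) hs.ne']
      field_simp
  rw [sum_congr rfl fun x _ => key x, sum_sub_distrib, sum_add_distrib, sum_add_distrib,
    ← sum_mul, hν.2, ← sum_div, ← hs_def, div_self hs.ne', relEnt]
  ring

lemma relEnt_nonneg {ν μ : α → ℝ} (hν : IsProb ν) (hμ : ∀ x, 0 ≤ μ x)
    (hac : ∀ x, ν x ≠ 0 → μ x ≠ 0) : 0 ≤ relEnt ν μ := by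
  rw [relEnt_eq_sum_klFun hν hμ hac]
  have hs := sum_pos_of_isProb hν hμ hac
  exact sum_nonneg fun x _ => mul_nonneg (div_nonneg (hμ x) hs.le)
    (klFun_nonneg (div_nonneg (hν.1 x) (div_nonneg (hμ x) hs.le)))

/-- Pinsker's inequality. -/
lemma sum_abs_sub_sq_le {ν μ : α → ℝ} (hν : IsProb ν) (hμ : ∀ x, 0 ≤ μ x)
    (hac : ∀ x, ν x ≠ 0 → μ x ≠ 0) :
    (∑ x, |ν x - μ x / ∑ x, μ x|) ^ 2 ≤ 2 * relEnt ν μ := by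
  have hs := sum_pos_of_isProb hν hμ hac
  rw [relEnt_eq_sum_klFun hν hμ hac]
  set s := ∑ x, μ x with hs_def
  have hm : ∀ x, 0 ≤ μ x / s := fun x => div_nonneg (hμ x) hs.le
  have hf : ∀ x, 0 ≤ ν x / (μ x / s) := fun x => div_nonneg (hν.1 x) (hm x)
  have hfm : ∀ x, μ x / s * (ν x / (μ x / s)) = ν x := by
    intro x
    by_cases hx : ν x = 0
    · simp [hx]
    · have := hac x hx
      field_simp
  -- Cauchy–Schwarz: the first weights sum to `2/3 + 4/3 = 2`, the second ones to the entropy.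
  have h := sum_sq_le_sum_mul_sum_of_sq_le_mul univ
    (r := fun x => |ν x - μ x / s|)
    (f := fun x => μ x / s * ((2 * (ν x / (μ x / s)) + 4) / 3))
    (g := fun x => μ x / s * klFun (ν x / (μ x / s)))
    (fun x _ => mul_nonneg (hm x) (by have := hf x; positivity))
    (fun x _ => mul_nonneg (hm x) (klFun_nonneg (hf x)))
    (fun x _ => by
      have h1 := three_mul_sub_one_sq_le_klFun (hf x)
      have h2 : ν x - μ x / s = μ x / s * (ν x / (μ x / s) - 1) := by rw [mul_sub, hfm]; ring
      rw [sq_abs, h2, mul_pow]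
      have h3 := mul_le_mul_of_nonneg_left h1 (mul_nonneg (hm x) (hm x))
      linarith)
  refine h.trans (le_of_eq ?_)
  congr 1
  have : ∀ x, μ x / s * ((2 * (ν x / (μ x / s)) + 4) / 3) = 2 / 3 * ν x + 4 / 3 * (μ x / s) := by
    intro x
    have := hfm x
    linear_combination (2 / 3) * this
  rw [sum_congr rfl fun x _ => this x, sum_add_distrib, ← mul_sum, ← mul_sum, hν.2, ← sum_div,
    ← hs_def, div_self hs.ne']
  norm_num

lemma sum_posPart_eq {f g : α → ℝ} (h : ∑ x, f x = ∑ x, g x) :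
    2 * ∑ x, max (f x - g x) 0 = ∑ x, |f x - g x| := by
  have : ∀ x, |f x - g x| = 2 * max (f x - g x) 0 - (f x - g x) := by
    intro x
    rcases le_total (f x) (g x) with h | h
    · rw [abs_of_nonpos (by linarith), max_eq_right (by linarith)]; ring
    · rw [abs_of_nonneg (by linarith), max_eq_left (by linarith)]; ring
  rw [sum_congr rfl fun x _ => this x, sum_sub_distrib, ← mul_sum, sum_sub_distrib, h]
  ring

/-- The left side is the squared total variation distance. The triangle inequality through the
normalized `m`, then Pinsker's inequality for each of the two terms, give the bound. -/
lemma sum_posPart_sub_sq_le {a b : ℝ} (ha : 0 < a) (hb : 0 < b) (hab : 1 / a + 1 / b = 1)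
    {M₁ M₂ m : α → ℝ} (h₁ : IsProb M₁) (h₂ : IsProb M₂) (hm : ∀ x, 0 ≤ m x)
    (hac₁ : ∀ x, M₁ x ≠ 0 → m x ≠ 0) (hac₂ : ∀ x, M₂ x ≠ 0 → m x ≠ 0) :
    (∑ x, max (M₁ x - M₂ x) 0) ^ 2 ≤ (a * relEnt M₁ m + b * relEnt M₂ m) / 2 := by
  have hs := sum_pos_of_isProb h₁ hm hac₁
  set s := ∑ x, m x with hs_def
  have hms : ∑ x, m x / s = 1 := by rw [← sum_div, ← hs_def, div_self hs.ne']
  have e₁ := sum_posPart_eq (f := M₁) (g := fun x => m x / s) (h₁.2.trans hms.symm)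
  have e₂ := sum_posPart_eq (f := M₂) (g := fun x => m x / s) (h₂.2.trans hms.symm)
  have e₃ := sum_posPart_eq (f := M₁) (g := M₂) (h₁.2.trans h₂.2.symm)
  have p₁ := sum_abs_sub_sq_le h₁ hm hac₁
  have p₂ := sum_abs_sub_sq_le h₂ hm hac₂
  rw [← hs_def] at p₁ p₂
  have tri : ∑ x, |M₁ x - M₂ x| ≤ ∑ x, |M₁ x - m x / s| + ∑ x, |M₂ x - m x / s| := by
    rw [← sum_add_distrib]
    refine sum_le_sum fun x _ => ?_
    rw [abs_sub_comm (M₂ x)]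
    exact abs_sub_le _ _ _
  have h0 : 0 ≤ ∑ x, |M₁ x - M₂ x| := sum_nonneg fun x _ => abs_nonneg _
  have hc := add_sq_le_of_conj ha hb hab (∑ x, |M₁ x - m x / s|) (∑ x, |M₂ x - m x / s|)
  have h4 : (∑ x, |M₁ x - M₂ x|) ^ 2 ≤ (∑ x, |M₁ x - m x / s| + ∑ x, |M₂ x - m x / s|) ^ 2 :=
    pow_le_pow_left₀ h0 tri 2
  rw [← e₃] at h4
  nlinarith [mul_le_mul_of_nonneg_left p₁ ha.le, mul_le_mul_of_nonneg_left p₂ hb.le]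

lemma IsProb.sum_mul_sq_le {q : α → ℝ} (hq : IsProb q) (f : α → ℝ) :
    (∑ k, q k * f k) ^ 2 ≤ ∑ k, q k * f k ^ 2 := by
  have := sum_sq_le_sum_mul_sum_of_sq_le_mul univ (r := fun k => q k * f k) (f := q)
    (g := fun k => q k * f k ^ 2) (fun k _ => hq.1 k)
    (fun k _ => mul_nonneg (hq.1 k) (sq_nonneg _)) (fun k _ => le_of_eq (by ring))
  rwa [hq.2, one_mul] at this

/-- A transport kernel between two probability vectors that moves as little mass as possible. -/
lemma exists_minimal_transport {a b : ℝ} (ha : 0 < a) (hb : 0 < b) (hab : 1 / a + 1 / b = 1)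
    {M₁ M₂ m : ι → ℝ} (h₁ : IsProb M₁) (h₂ : IsProb M₂) (hm : ∀ x, 0 ≤ m x)
    (hac₁ : ∀ x, M₁ x ≠ 0 → m x ≠ 0) (hac₂ : ∀ x, M₂ x ≠ 0 → m x ≠ 0) :
    ∃ q : ι → ι → ℝ, (∀ i, IsProb (q i)) ∧ (∀ k, ∑ i, M₁ i * q i k = M₂ k) ∧
      ∑ i, M₁ i * (1 - q i i) ^ 2 ≤ 2 * (a * relEnt M₁ m + b * relEnt M₂ m) ∧
      (∑ i, M₁ i * (1 - q i i)) ^ 2 ≤ (a * relEnt M₁ m + b * relEnt M₂ m) / 2 ∧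
      ∀ i, M₁ i = 0 → q i i = 1 := by
  set D := ∑ x, max (M₁ x - M₂ x) 0 with hD
  have hD' : ∑ x, max (M₂ x - M₁ x) 0 = D := by
    have e₁ := sum_posPart_eq (h₁.2.trans h₂.2.symm)
    have e₂ := sum_posPart_eq (h₂.2.trans h₁.2.symm)
    have : ∑ x, |M₁ x - M₂ x| = ∑ x, |M₂ x - M₁ x| := sum_congr rfl fun x _ => abs_sub_comm _ _
    linarith
  have hD0 : 0 ≤ D := sum_nonneg fun x _ => le_max_right _ _
  -- The common mass `min (M₁ i) (M₂ i)` stays, and the excess is spread in proportion to the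
  -- deficits. Rows of mass zero are set to the identity, which yields the last claim.
  let q : ι → ι → ℝ := fun i k => if M₁ i = 0 then (if k = i then 1 else 0) else
    (if k = i then min (M₁ i) (M₂ i) / M₁ i else 0) +
      max (M₁ i - M₂ i) 0 / M₁ i * (max (M₂ k - M₁ k) 0 / D)
  have hpp : ∀ i, max (M₁ i - M₂ i) 0 * max (M₂ i - M₁ i) 0 = 0 := by
    intro i
    rcases le_total (M₁ i) (M₂ i) with h | h
    · rw [max_eq_right (by linarith), zero_mul]
    · rw [max_eq_right (a := M₂ i - M₁ i) (by linarith), mul_zero]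
  have hmm : ∀ i, min (M₁ i) (M₂ i) + max (M₁ i - M₂ i) 0 = M₁ i := by
    intro i
    rcases le_total (M₁ i) (M₂ i) with h | h
    · rw [max_eq_right (by linarith), min_eq_left h]; ring
    · rw [max_eq_left (by linarith), min_eq_right h]; ring
  have hmm2 : ∀ i, min (M₁ i) (M₂ i) + max (M₂ i - M₁ i) 0 = M₂ i := by
    intro i
    rcases le_total (M₁ i) (M₂ i) with h | h
    · rw [max_eq_left (by linarith), min_eq_left h]; ring
    · rw [max_eq_right (by linarith), min_eq_right h]; ring
  -- If `D = 0` then `D / D = 0` by convention, but every excess vanishes as well.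
  have hDz : ∀ i, max (M₁ i - M₂ i) 0 * (D / D) = max (M₁ i - M₂ i) 0 := by
    intro i
    by_cases h : D = 0
    · have := (sum_eq_zero_iff_of_nonneg (fun x _ => le_max_right _ _)).1 (hD.symm.trans h) i
        (mem_univ _)
      simp [this]
    · rw [div_self h, mul_one]
  have hDz' : ∀ i, max (M₂ i - M₁ i) 0 * (D / D) = max (M₂ i - M₁ i) 0 := by
    intro i
    by_cases h : D = 0
    · have := (sum_eq_zero_iff_of_nonneg (fun x _ => le_max_right _ _)).1 (hD'.trans h) i
        (mem_univ _)
      simp [this]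
    · rw [div_self h, mul_one]
  have hMq : ∀ i k, M₁ i * q i k = (if k = i then min (M₁ i) (M₂ i) else 0) +
      max (M₁ i - M₂ i) 0 * (max (M₂ k - M₁ k) 0 / D) := by
    intro i k
    by_cases h : M₁ i = 0
    · have h2 := h₂.1 i
      simp only [q, if_pos h, h, zero_sub, zero_mul]
      rw [max_eq_right (by linarith), min_eq_left h2]
      simp
    · simp only [q, if_neg h]
      split_ifs <;> (field_simp; try simp)
  have hR : ∀ i, M₁ i * (1 - q i i) = max (M₁ i - M₂ i) 0 := by
    intro i
    rw [mul_sub, hMq, if_pos rfl, ← mul_div_assoc, hpp, zero_div]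
    have := hmm i
    linarith
  refine ⟨q, fun i => ⟨fun k => ?_, ?_⟩, fun k => ?_, ?_, ?_, fun i hi => by simp [q, hi]⟩
  · have := h₁.1 i
    have := h₂.1 i
    simp only [q]
    split_ifs <;> positivity
  · by_cases h : M₁ i = 0
    · simp [q, h]
    · simp only [q, if_neg h]
      rw [sum_add_distrib, ← mul_sum, ← sum_div, hD', sum_ite_eq' univ i, if_pos (mem_univ _),
        div_mul_eq_mul_div, hDz, ← add_div, hmm, div_self h]
  · rw [sum_congr rfl fun i _ => hMq i k, sum_add_distrib, ← sum_mul, ← hD, sum_ite_eq univ k,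
      if_pos (mem_univ _), mul_div_left_comm, hDz', hmm2]
  · have hs := sum_pos_of_isProb h₁ hm hac₁
    rw [relEnt_eq_sum_klFun h₁ hm hac₁, relEnt_eq_sum_klFun h₂ hm hac₂]
    set s := ∑ x, m x with hs_def
    rw [mul_sum, mul_sum, ← sum_add_distrib, mul_sum]
    refine sum_le_sum fun i _ => ?_
    have k₁ := klFun_nonneg (x := M₁ i / (m i / s))
      (div_nonneg (h₁.1 i) (div_nonneg (hm i) hs.le))
    have k₂ := klFun_nonneg (x := M₂ i / (m i / s))
      (div_nonneg (h₂.1 i) (div_nonneg (hm i) hs.le))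
    by_cases h : M₁ i = 0
    · rw [h, zero_mul]
      rw [h] at k₁
      have := div_nonneg (hm i) hs.le
      positivity
    have hmi : 0 < m i / s := div_pos ((hm i).lt_of_ne' (hac₁ i h)) hs
    have hM : 0 < M₁ i := (h₁.1 i).lt_of_ne' h
    have key := posPart_sub_sq_le ha hb hab (x := M₁ i / (m i / s)) (y := M₂ i / (m i / s))
      (div_nonneg (h₁.1 i) hmi.le) (div_nonneg (h₂.1 i) hmi.le)
    have e : max (M₁ i / (m i / s) - M₂ i / (m i / s)) 0 = max (M₁ i - M₂ i) 0 / (m i / s) := by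
      rw [← sub_div, ← zero_div (m i / s), max_div_div_right hmi.le, zero_div]
    rw [e, div_pow, div_mul_eq_mul_div, div_le_div_iff₀ (by positivity) hmi, ← hR i] at key
    set w := m i / s
    -- Marton's scalar inequality at the densities `M₁ i / w` and `M₂ i / w` is the claim times the
    -- positive factor `w * M₁ i`, because the mass leaving `i` is the excess `max (M₁ i - M₂ i) 0`.
    have key2 : w * (M₁ i * (M₁ i * (1 - q i i) ^ 2)) ≤
        w * (M₁ i * (2 * (a * (w * klFun (M₁ i / w)) + b * (w * klFun (M₂ i / w))))) := by
      nlinarith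
    exact le_of_mul_le_mul_left (le_of_mul_le_mul_left key2 hmi) hM
  · rw [sum_congr rfl fun i _ => hR i]
    exact sum_posPart_sub_sq_le ha hb hab h₁ h₂ hm hac₁ hac₂

end Finite

/-! ### Disintegration along a label, chain rule and gluing of transports. -/

section Disintegration

variable {α ι : Type*} [Fintype α] [Fintype ι] [DecidableEq ι]

/-- The restriction of a vector to the fibre of `x` over `i`. -/
def fiberPart (x : α → ι) (ν : α → ℝ) (i : ι) (σ : α) : ℝ := if x σ = i then ν σ else 0

/-- The push-forward of a vector by `x`. -/
def label (x : α → ι) (ν : α → ℝ) (i : ι) : ℝ := ∑ σ, fiberPart x ν i σ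

/-- The normalized restriction of a vector to the fibre of `x` over `i`. -/
noncomputable def fiberCond (x : α → ι) (ν : α → ℝ) (i : ι) (σ : α) : ℝ :=
  fiberPart x ν i σ / label x ν i

variable {x : α → ι} {ν μ : α → ℝ}

lemma fiberPart_nonneg (hν : ∀ σ, 0 ≤ ν σ) (i : ι) (σ : α) : 0 ≤ fiberPart x ν i σ := by
  unfold fiberPart
  split_ifs
  exacts [hν σ, le_rfl]

lemma label_nonneg (hν : ∀ σ, 0 ≤ ν σ) (i : ι) : 0 ≤ label x ν i :=
  sum_nonneg fun σ _ => fiberPart_nonneg hν i σ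

lemma sum_fiberPart_mul (f : ι → α → ℝ) :
    ∑ i, ∑ σ, fiberPart x ν i σ * f i σ = ∑ σ, ν σ * f (x σ) σ := by
  rw [sum_comm]
  refine sum_congr rfl fun σ _ => ?_
  simp only [fiberPart, ite_mul, zero_mul]
  rw [sum_ite_eq univ (x σ), if_pos (mem_univ _)]

lemma sum_label : ∑ i, label x ν i = ∑ σ, ν σ := by
  have := sum_fiberPart_mul (x := x) (ν := ν) fun _ _ => 1
  simpa [label] using this

lemma sum_mul_comp (f : ι → ℝ) : ∑ σ, ν σ * f (x σ) = ∑ i, label x ν i * f i := by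
  rw [← sum_fiberPart_mul (x := x) (ν := ν) fun i _ => f i]
  simp only [label, sum_mul]

lemma isProb_label (hν : IsProb ν) : IsProb (label x ν) :=
  ⟨label_nonneg hν.1, by rw [sum_label, hν.2]⟩

lemma isProb_fiberCond (hν : ∀ σ, 0 ≤ ν σ) {i : ι} (hi : label x ν i ≠ 0) :
    IsProb (fiberCond x ν i) :=
  ⟨fun σ => div_nonneg (fiberPart_nonneg hν i σ) (label_nonneg hν i), by
    simp only [fiberCond]
    rw [← sum_div]
    exact div_self hi⟩

lemma fiberPart_ne_zero_iff {i : ι} {σ : α} : fiberPart x ν i σ ≠ 0 ↔ x σ = i ∧ ν σ ≠ 0 := by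
  simp [fiberPart]

lemma fiberCond_ne_zero {i : ι} {σ : α} (h : fiberCond x ν i σ ≠ 0) : x σ = i ∧ ν σ ≠ 0 := by
  refine fiberPart_ne_zero_iff.1 fun h' => h ?_
  rw [fiberCond, h', zero_div]

lemma exists_of_label_ne_zero {i : ι} (h : label x ν i ≠ 0) : ∃ σ, x σ = i ∧ ν σ ≠ 0 := by
  obtain ⟨σ, -, hσ⟩ := exists_ne_zero_of_sum_ne_zero h
  exact ⟨σ, fiberPart_ne_zero_iff.1 hσ⟩

lemma label_ne_zero (hν : ∀ σ, 0 ≤ ν σ) {σ : α} (h : ν σ ≠ 0) : label x ν (x σ) ≠ 0 := by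
  intro h'
  have := (sum_eq_zero_iff_of_nonneg fun τ _ => fiberPart_nonneg hν (x σ) τ).1 h' σ (mem_univ _)
  simp [fiberPart, h] at this

lemma label_mul_fiberCond (hν : ∀ σ, 0 ≤ ν σ) (i : ι) (σ : α) :
    label x ν i * fiberCond x ν i σ = fiberPart x ν i σ := by
  by_cases h : label x ν i = 0
  · have := (sum_eq_zero_iff_of_nonneg fun τ _ => fiberPart_nonneg hν i τ).1 h σ (mem_univ _)
    rw [h, this, zero_mul]
  · rw [fiberCond, mul_div_cancel₀ _ h]

/-- The chain rule for relative entropy. -/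
lemma relEnt_chain (hν : IsProb ν) (hμ : ∀ σ, 0 ≤ μ σ) (hac : ∀ σ, ν σ ≠ 0 → μ σ ≠ 0) :
    relEnt ν μ = relEnt (label x ν) (label x μ) +
      ∑ i, label x ν i * relEnt (fiberCond x ν i) (fiberPart x μ i) := by
  have key : ∀ i, label x ν i * relEnt (fiberCond x ν i) (fiberPart x μ i) =
      ∑ σ, fiberPart x ν i σ * Real.log (ν σ / μ σ) -
        label x ν i * Real.log (label x ν i / label x μ i) := by
    intro i
    by_cases hi : label x ν i = 0
    · have : ∀ σ, fiberPart x ν i σ = 0 := fun σ =>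
        (sum_eq_zero_iff_of_nonneg fun τ _ => fiberPart_nonneg hν.1 i τ).1 hi σ (mem_univ _)
      simp [hi, this]
    · obtain ⟨τ, rfl, hτ⟩ := exists_of_label_ne_zero hi
      have hmi : label x μ (x τ) ≠ 0 := label_ne_zero hμ (hac τ hτ)
      rw [relEnt, mul_add, mul_sum, Real.log_div hi hmi]
      have : ∀ σ, label x ν (x τ) * (fiberCond x ν (x τ) σ *
          Real.log (fiberCond x ν (x τ) σ / fiberPart x μ (x τ) σ)) =
          fiberPart x ν (x τ) σ * Real.log (ν σ / μ σ) -
            fiberPart x ν (x τ) σ * Real.log (label x ν (x τ)) := by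
        intro σ
        rw [← mul_assoc, label_mul_fiberCond hν.1]
        by_cases h0 : fiberPart x ν (x τ) σ = 0
        · simp [h0]
        · obtain ⟨h1, h2⟩ := fiberPart_ne_zero_iff.1 h0
          have e : fiberCond x ν (x τ) σ / fiberPart x μ (x τ) σ =
              ν σ / μ σ / label x ν (x τ) := by
            simp only [fiberCond, fiberPart, if_pos h1]
            rw [div_right_comm]
          rw [e, Real.log_div (div_ne_zero h2 (hac σ h2)) hi]
          ring
      rw [sum_congr rfl fun σ _ => this σ, sum_sub_distrib, ← sum_mul]
      have e2 : ∑ σ, fiberPart x ν (x τ) σ = label x ν (x τ) := rfl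
      have e3 : ∑ σ, fiberPart x μ (x τ) σ = label x μ (x τ) := rfl
      rw [e2, e3]
      ring
  rw [sum_congr rfl fun i _ => key i, sum_sub_distrib, sum_fiberPart_mul, relEnt, relEnt, sum_label]
  ring

/-- The factor `κ` cancels because `relEnt` normalizes its reference vector. Hence shifting a
conditional law to another fibre costs no entropy. -/
lemma relEnt_comp_symm {μ' : α → ℝ} (Θ : α ≃ α) {κ : ℝ} (hκ : 0 < κ) (hν : IsProb ν)
    (hμ : ∀ σ, 0 ≤ μ σ) (hac : ∀ σ, ν σ ≠ 0 → μ σ ≠ 0) (h : ∀ σ, μ' (Θ σ) = κ * μ σ) :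
    relEnt (fun σ => ν (Θ.symm σ)) μ' = relEnt ν μ := by
  have hs := sum_pos_of_isProb hν hμ hac
  unfold relEnt
  rw [← Equiv.sum_comp Θ, ← Equiv.sum_comp Θ μ']
  simp only [Equiv.symm_apply_apply, h]
  rw [← mul_sum, Real.log_mul hκ.ne' hs.ne']
  have : ∀ σ, ν σ * Real.log (ν σ / (κ * μ σ)) =
      ν σ * Real.log (ν σ / μ σ) - ν σ * Real.log κ := by
    intro σ
    by_cases h0 : ν σ = 0
    · simp [h0]
    · rw [mul_comm κ, ← div_div, Real.log_div (div_ne_zero h0 (hac σ h0)) hκ.ne']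
      ring
  rw [sum_congr rfl fun σ _ => this σ, sum_sub_distrib, ← sum_mul, hν.2]
  ring

/-- The conditional law of `ν` on the fibre over `i`, moved to the fibre over `k`. -/
noncomputable def shiftCond (x : α → ι) (Θ : ι → ι → α ≃ α) (ν : α → ℝ) (i k : ι) (σ : α) : ℝ :=
  fiberCond x ν i ((Θ i k).symm σ)

variable {Θ : ι → ι → α ≃ α}

/-- Compatibility of the shifts `Θ i k` with the conditional laws of `μ`. -/
def ShiftCompatible (x : α → ι) (Θ : ι → ι → α ≃ α) (μ : α → ℝ) : Prop :=
  ∀ i k, (∃ σ, x σ = i ∧ μ σ ≠ 0) → (∃ σ, x σ = k ∧ μ σ ≠ 0) →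
    ∃ κ : ℝ, 0 < κ ∧ ∀ σ, fiberPart x μ k (Θ i k σ) = κ * fiberPart x μ i σ

lemma isProb_shiftCond (hν : ∀ σ, 0 ≤ ν σ) {i : ι} (hi : label x ν i ≠ 0) (k : ι) :
    IsProb (shiftCond x Θ ν i k) :=
  ⟨fun σ => (isProb_fiberCond hν hi).1 _, by
    simp only [shiftCond]
    rw [Equiv.sum_comp (Θ i k).symm (fiberCond x ν i)]
    exact (isProb_fiberCond hν hi).2⟩

lemma shiftCond_ac (hΘ : ShiftCompatible x Θ μ) (hac : ∀ σ, ν σ ≠ 0 → μ σ ≠ 0) {i k : ι}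
    (hk : ∃ σ, x σ = k ∧ μ σ ≠ 0) (σ : α) (h : shiftCond x Θ ν i k σ ≠ 0) :
    fiberPart x μ k σ ≠ 0 := by
  obtain ⟨h1, h2⟩ := fiberCond_ne_zero h
  obtain ⟨κ, hκ, h3⟩ := hΘ i k ⟨_, h1, hac _ h2⟩ hk
  have := h3 ((Θ i k).symm σ)
  rw [Equiv.apply_symm_apply] at this
  rw [this]
  exact mul_ne_zero hκ.ne' (fiberPart_ne_zero_iff.2 ⟨h1, hac _ h2⟩)

lemma fiberCond_ac (hac : ∀ σ, ν σ ≠ 0 → μ σ ≠ 0) {k : ι} (σ : α)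
    (h : fiberCond x ν k σ ≠ 0) : fiberPart x μ k σ ≠ 0 := by
  obtain ⟨h1, h2⟩ := fiberCond_ne_zero h
  exact fiberPart_ne_zero_iff.2 ⟨h1, hac _ h2⟩

/-- One step of the transport: the labels are transported by `q`, at the cost of the entropy of
the labels; what remains is the entropy of the conditional laws. -/
lemma exists_label_transport {a b : ℝ} (ha : 0 < a) (hb : 0 < b) (hab : 1 / a + 1 / b = 1)
    {ν₁ ν₂ : α → ℝ} (h₁ : IsProb ν₁) (h₂ : IsProb ν₂) (hμ : ∀ σ, 0 ≤ μ σ)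
    (hac₁ : ∀ σ, ν₁ σ ≠ 0 → μ σ ≠ 0) (hac₂ : ∀ σ, ν₂ σ ≠ 0 → μ σ ≠ 0)
    (hΘ : ShiftCompatible x Θ μ) :
    ∃ (q : ι → ι → ℝ) (E₀ : ℝ), (∀ i, IsProb (q i)) ∧
      (∀ k, ∑ i, label x ν₁ i * q i k = label x ν₂ k) ∧
      ∑ i, label x ν₁ i * (1 - q i i) ^ 2 ≤ 2 * E₀ ∧
      (∑ i, label x ν₁ i * (1 - q i i)) ^ 2 ≤ E₀ / 2 ∧
      E₀ + ∑ i, ∑ k, label x ν₁ i * q i k *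
        (a * relEnt (shiftCond x Θ ν₁ i k) (fiberPart x μ k) +
          b * relEnt (fiberCond x ν₂ k) (fiberPart x μ k)) =
        a * relEnt ν₁ μ + b * relEnt ν₂ μ ∧
      (∀ i k, label x ν₁ i ≠ 0 → q i k ≠ 0 → label x ν₂ k ≠ 0) ∧
      ∀ i, label x ν₁ i = 0 → q i i = 1 := by
  obtain ⟨q, hq, hm, hR, hR', hq1⟩ := exists_minimal_transport ha hb hab
    (isProb_label (x := x) h₁) (isProb_label (x := x) h₂) (label_nonneg (x := x) hμ)
    (fun i hi => by
      obtain ⟨σ, rfl, hσ⟩ := exists_of_label_ne_zero hi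
      exact label_ne_zero hμ (hac₁ σ hσ))
    (fun i hi => by
      obtain ⟨σ, rfl, hσ⟩ := exists_of_label_ne_zero hi
      exact label_ne_zero hμ (hac₂ σ hσ))
  have hpos : ∀ i k, label x ν₁ i ≠ 0 → q i k ≠ 0 → label x ν₂ k ≠ 0 := by
    intro i k hi hk h0
    rw [← hm k] at h0
    have := (sum_eq_zero_iff_of_nonneg fun j _ =>
      mul_nonneg (label_nonneg (x := x) h₁.1 j) ((hq j).1 k)).1 h0 i (mem_univ _)
    exact mul_ne_zero hi hk this
  refine ⟨q, _, hq, hm, hR, hR', ?_, hpos, hq1⟩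
  rw [relEnt_chain (x := x) h₁ hμ hac₁, relEnt_chain (x := x) h₂ hμ hac₂]
  have e : ∀ i k, label x ν₁ i * q i k *
        (a * relEnt (shiftCond x Θ ν₁ i k) (fiberPart x μ k) +
          b * relEnt (fiberCond x ν₂ k) (fiberPart x μ k)) =
      q i k * (a * (label x ν₁ i * relEnt (fiberCond x ν₁ i) (fiberPart x μ i))) +
        label x ν₁ i * q i k * (b * relEnt (fiberCond x ν₂ k) (fiberPart x μ k)) := by
    intro i k
    by_cases hi : label x ν₁ i = 0
    · simp [hi]
    by_cases hk : q i k = 0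
    · simp [hk]
    obtain ⟨σ, hσ, hσ'⟩ := exists_of_label_ne_zero hi
    obtain ⟨τ, hτ, hτ'⟩ := exists_of_label_ne_zero (hpos i k hi hk)
    obtain ⟨κ, hκ, hκ'⟩ := hΘ i k ⟨σ, hσ, hac₁ _ hσ'⟩ ⟨τ, hτ, hac₂ _ hτ'⟩
    have := relEnt_comp_symm (Θ i k) hκ (isProb_fiberCond h₁.1 hi) (fiberPart_nonneg (x := x) hμ i)
      (fiberCond_ac hac₁) hκ'
    unfold shiftCond
    rw [this]
    ring
  rw [sum_congr rfl fun i _ => sum_congr rfl fun k _ => e i k]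
  simp only [sum_add_distrib]
  have e1 : ∑ i, ∑ k, q i k *
      (a * (label x ν₁ i * relEnt (fiberCond x ν₁ i) (fiberPart x μ i))) =
      a * ∑ i, label x ν₁ i * relEnt (fiberCond x ν₁ i) (fiberPart x μ i) := by
    rw [mul_sum]
    refine sum_congr rfl fun i _ => ?_
    rw [← sum_mul, (hq i).2, one_mul]
  have e2 : ∑ i, ∑ k, label x ν₁ i * q i k *
      (b * relEnt (fiberCond x ν₂ k) (fiberPart x μ k)) =
      b * ∑ k, label x ν₂ k * relEnt (fiberCond x ν₂ k) (fiberPart x μ k) := by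
    rw [sum_comm, mul_sum]
    refine sum_congr rfl fun k _ => ?_
    rw [← sum_mul, hm]
    ring
  rw [e1, e2]
  ring

/-- Transition matrices that transport `ν₁` to `ν₂`. -/
def IsTransport (p : α → α → ℝ) (ν₁ ν₂ : α → ℝ) : Prop :=
  (∀ σ, IsProb (p σ)) ∧ ∀ τ, ∑ σ, ν₁ σ * p σ τ = ν₂ τ

/-- The transport assembled from a transport of the labels and transports of the fibres. -/
noncomputable def glue (x : α → ι) (Θ : ι → ι → α ≃ α) (q : ι → ι → ℝ)
    (P : ι → ι → α → α → ℝ) (σ τ : α) : ℝ :=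
  ∑ k, q (x σ) k * P (x σ) k (Θ (x σ) k σ) τ

/-- Given the label `i`, the shifted point has law `shiftCond x Θ ν i k`. Mean costs of a glued
transport thereby reduce to means over the fibres, weighted by the coupling of the labels. -/
lemma sum_mul_glue (hν : ∀ σ, 0 ≤ ν σ) (q : ι → ι → ℝ) (G : ι → ι → α → ℝ) :
    ∑ σ, ν σ * ∑ k, q (x σ) k * G (x σ) k (Θ (x σ) k σ) =
      ∑ i, ∑ k, label x ν i * q i k * ∑ σ, shiftCond x Θ ν i k σ * G i k σ := by
  rw [← sum_fiberPart_mul (x := x) (ν := ν) fun i σ => ∑ k, q i k * G i k (Θ i k σ)]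
  refine sum_congr rfl fun i _ => ?_
  simp only [mul_sum]
  rw [sum_comm]
  refine sum_congr rfl fun k _ => ?_
  rw [← Equiv.sum_comp (Θ i k) fun σ => label x ν i * q i k * (shiftCond x Θ ν i k σ * G i k σ)]
  refine sum_congr rfl fun σ _ => ?_
  rw [shiftCond, Equiv.symm_apply_apply, ← label_mul_fiberCond hν i σ]
  ring

lemma isTransport_glue {ν₁ ν₂ : α → ℝ} (h₁ : IsProb ν₁) (h₂ : IsProb ν₂) {q : ι → ι → ℝ}
    (hq : ∀ i, IsProb (q i)) (hm : ∀ k, ∑ i, label x ν₁ i * q i k = label x ν₂ k)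
    {P : ι → ι → α → α → ℝ} (hP : ∀ i k σ, IsProb (P i k σ))
    (hP' : ∀ i k, label x ν₁ i ≠ 0 → q i k ≠ 0 →
      IsTransport (P i k) (shiftCond x Θ ν₁ i k) (fiberCond x ν₂ k)) :
    IsTransport (glue x Θ q P) ν₁ ν₂ := by
  refine ⟨fun σ => ⟨fun τ => ?_, ?_⟩, fun τ => ?_⟩
  · exact sum_nonneg fun k _ => mul_nonneg ((hq _).1 k) ((hP _ _ _).1 τ)
  · unfold glue
    rw [sum_comm]
    simp only [← mul_sum, (hP _ _ _).2, mul_one]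
    exact (hq _).2
  · have := sum_mul_glue (x := x) (Θ := Θ) h₁.1 q fun i k σ => P i k σ τ
    simp only [glue]
    rw [this]
    have e : ∀ i k, label x ν₁ i * q i k * ∑ σ, shiftCond x Θ ν₁ i k σ * P i k σ τ =
        label x ν₁ i * q i k * fiberCond x ν₂ k τ := by
      intro i k
      by_cases hi : label x ν₁ i = 0
      · simp [hi]
      by_cases hk : q i k = 0
      · simp [hk]
      rw [(hP' i k hi hk).2 τ]
    rw [sum_congr rfl fun i _ => sum_congr rfl fun k _ => e i k, sum_comm]
    simp only [← sum_mul, hm, label_mul_fiberCond h₂.1]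
    simp [fiberPart]

end Disintegration

/-! ### Positions of values as labels, and shifts between fibres. -/

section Swap

variable {n : ℕ} {G : Subgroup (Equiv.Perm (Fin n))}

instance permSubgroupFintype : Fintype G := Fintype.ofFinite G

/-- The position of the value `k`. -/
def pos (σ : G) (k : Fin n) : Fin n := (σ : Equiv.Perm (Fin n)).symm k

lemma pos_mul (σ θ : G) (k : Fin n) : pos (σ * θ) k = pos θ (pos σ k) := rfl

lemma pos_one (k : Fin n) : pos (1 : G) k = k := rfl

lemma apply_pos (σ : G) (k : Fin n) : (σ : Equiv.Perm (Fin n)) (pos σ k) = k :=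
  Equiv.apply_symm_apply _ _

lemma pos_apply (σ : G) (k : Fin n) : pos σ ((σ : Equiv.Perm (Fin n)) k) = k :=
  Equiv.symm_apply_apply _ _

lemma pos_inv (σ : G) (k : Fin n) : pos σ⁻¹ k = (σ : Equiv.Perm (Fin n)) k := rfl

lemma pos_injective (σ : G) : Function.Injective (pos σ) := (Equiv.injective _)

lemma pos_eq_iff {σ : G} {k l : Fin n} : pos σ k = l ↔ (σ : Equiv.Perm (Fin n)) l = k := by
  rw [pos, Equiv.symm_apply_eq, eq_comm]

/-- The values in `J` have the same positions in `σ` and in `τ`. -/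
def Agree (J : Finset (Fin n)) (σ τ : G) : Prop := ∀ k ∈ J, pos σ k = pos τ k

/-- Two fibres of `pos · j` on `{σ | Agree J σ ρ}` carry the same conditional law of `μ`, up to a
right translation by some `θ` with `Q θ`. -/
def Swap (Q : G → Prop) (μ : G → ℝ) (J : Finset (Fin n)) (j : Fin n) : Prop :=
  ∀ σ₁ σ₂ : G, Agree J σ₁ σ₂ → μ σ₁ ≠ 0 → μ σ₂ ≠ 0 →
    ∃ θ : G, Q θ ∧ (θ : Equiv.Perm (Fin n)) (pos σ₂ j) = pos σ₁ j ∧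
      (∀ k ∈ J, (θ : Equiv.Perm (Fin n)) (pos σ₁ k) = pos σ₁ k) ∧
      ∃ κ : ℝ, 0 < κ ∧ ∀ σ : G, Agree J σ σ₁ → pos σ j = pos σ₁ j → μ (σ * θ) = κ * μ σ

open Classical in
/-- The restriction of `μ` to `{σ | Agree J σ ρ}`. -/
def restr (μ : G → ℝ) (J : Finset (Fin n)) (ρ : G) (σ : G) : ℝ := if Agree J σ ρ then μ σ else 0

lemma restr_ne_zero {μ : G → ℝ} {J : Finset (Fin n)} {ρ σ : G} :
    restr μ J ρ σ ≠ 0 ↔ Agree J σ ρ ∧ μ σ ≠ 0 := by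
  simp [restr]

lemma restr_nonneg {μ : G → ℝ} (hμ : ∀ σ, 0 ≤ μ σ) (J : Finset (Fin n)) (ρ σ : G) :
    0 ≤ restr μ J ρ σ := by
  unfold restr
  split_ifs
  exacts [hμ σ, le_rfl]

lemma fiberPart_restr (μ : G → ℝ) {J : Finset (Fin n)} {j : Fin n} {ρ ρ' : G}
    (h : Agree J ρ' ρ) :
    fiberPart (fun σ => pos σ j) (restr μ J ρ) (pos ρ' j) = restr μ (insert j J) ρ' := by
  funext σ
  have : Agree (insert j J) σ ρ' ↔ pos σ j = pos ρ' j ∧ Agree J σ ρ := by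
    simp only [Agree, forall_mem_insert]
    refine and_congr_right fun _ => forall₂_congr fun k hk => ?_
    rw [h k hk]
  simp only [fiberPart, restr, this]
  split_ifs <;> simp_all

/-- One `θ` serves a whole pair of fibres, since fixing the positions of the values in `J` depends
only on `ρ`. For equal labels, or labels that `μ` does not charge, `θ = 1` is taken. -/
lemma Swap.exists_shift {Q : G → Prop} {μ : G → ℝ} {J : Finset (Fin n)} {j : Fin n}
    (h : Swap Q μ J j) (ρ : G) :
    ∃ θ : Fin n → Fin n → G, (∀ i, θ i i = 1) ∧
      ShiftCompatible (fun σ => pos σ j) (fun i k => Equiv.mulRight (θ i k)) (restr μ J ρ) ∧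
      ∀ i k, i ≠ k → (∃ σ, pos σ j = i ∧ restr μ J ρ σ ≠ 0) →
        (∃ σ, pos σ j = k ∧ restr μ J ρ σ ≠ 0) →
        Q (θ i k) ∧ (θ i k : Equiv.Perm (Fin n)) k = i ∧
          ∀ l ∈ J, (θ i k : Equiv.Perm (Fin n)) (pos ρ l) = pos ρ l := by
  have key : ∀ i k, ∃ θ : G, (i = k → θ = 1) ∧ (i ≠ k →
      (∃ σ, pos σ j = i ∧ restr μ J ρ σ ≠ 0) → (∃ σ, pos σ j = k ∧ restr μ J ρ σ ≠ 0) →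
        (Q θ ∧ (θ : Equiv.Perm (Fin n)) k = i ∧
          ∀ l ∈ J, (θ : Equiv.Perm (Fin n)) (pos ρ l) = pos ρ l) ∧
        ∃ κ : ℝ, 0 < κ ∧ ∀ σ, fiberPart (fun σ => pos σ j) (restr μ J ρ) k (σ * θ) =
          κ * fiberPart (fun σ => pos σ j) (restr μ J ρ) i σ) := by
    intro i k
    by_cases hik : i = k
    · exact ⟨1, fun _ => rfl, fun h => absurd hik h⟩
    by_cases hex : (∃ σ, pos σ j = i ∧ restr μ J ρ σ ≠ 0) ∧
        (∃ σ, pos σ j = k ∧ restr μ J ρ σ ≠ 0)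
    swap
    · exact ⟨1, fun h => absurd h hik, fun _ h1 h2 => absurd ⟨h1, h2⟩ hex⟩
    obtain ⟨⟨σ₁, rfl, hσ₁⟩, σ₂, rfl, hσ₂⟩ := hex
    rw [restr_ne_zero] at hσ₁ hσ₂
    have hag : Agree J σ₁ σ₂ := fun l hl => (hσ₁.1 l hl).trans (hσ₂.1 l hl).symm
    obtain ⟨θ, hQ, hθ, hfix, κ, hκ, hμ⟩ := h σ₁ σ₂ hag hσ₁.2 hσ₂.2
    have hfix' : ∀ l ∈ J, (θ : Equiv.Perm (Fin n)) (pos ρ l) = pos ρ l := by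
      intro l hl
      rw [← hσ₁.1 l hl]
      exact hfix l hl
    refine ⟨θ, fun h => absurd h hik, fun _ _ _ => ⟨⟨hQ, hθ, hfix'⟩, κ, hκ, fun σ => ?_⟩⟩
    -- Right translation by `θ` maps the fibre over `i` exactly onto the fibre over `k`, so outside
    -- of them both sides vanish.
    have e1 : pos (σ * θ) j = pos σ₂ j ↔ pos σ j = pos σ₁ j := by
      rw [pos_mul, pos_eq_iff, hθ, eq_comm]
    have e2 : Agree J (σ * θ) ρ ↔ Agree J σ ρ := by
      refine forall₂_congr fun l hl => ?_
      rw [pos_mul, pos_eq_iff, hfix' l hl, eq_comm]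
    simp only [fiberPart, restr, e1]
    by_cases c1 : pos σ j = pos σ₁ j
    · by_cases c2 : Agree J σ ρ
      · rw [if_pos c1, if_pos c1, if_pos c2, if_pos (e2.2 c2)]
        exact hμ σ (fun l hl => (c2 l hl).trans (hσ₁.1 l hl).symm) c1
      · rw [if_neg c2, if_neg (mt e2.1 c2)]
        simp
    · simp [c1]
  choose θ hθ1 hθ2 using key
  refine ⟨θ, fun i => hθ1 i i rfl, fun i k hi hk => ?_, fun i k hik hi hk => (hθ2 i k hik hi hk).1⟩
  by_cases hik : i = k
  · subst hik
    refine ⟨1, one_pos, fun σ => ?_⟩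
    simp [hθ1 i i rfl]
  · exact (hθ2 i k hik hi hk).2

lemma isTransport_single {α : Type*} [Fintype α] [DecidableEq α] {ν₁ ν₂ : α → ℝ} (ρ : α)
    (h₁ : IsProb ν₁) (h₂ : IsProb ν₂) (hs₁ : ∀ σ, ν₁ σ ≠ 0 → σ = ρ) (hs₂ : ∀ σ, ν₂ σ ≠ 0 → σ = ρ) :
    IsTransport (fun σ τ => if τ = σ then 1 else 0) ν₁ ν₂ := by
  have key : ∀ ν : α → ℝ, IsProb ν → (∀ σ, ν σ ≠ 0 → σ = ρ) → ν = fun σ => if σ = ρ then 1 else 0 := by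
    intro ν h hs
    have h0 : ∀ σ, σ ≠ ρ → ν σ = 0 := fun σ hσ => by_contra fun h' => hσ (hs σ h')
    funext σ
    split_ifs with hσ
    · rw [hσ, ← h.2, sum_eq_single ρ (fun τ _ hτ => h0 τ hτ) (by simp)]
    · exact h0 σ hσ
  refine ⟨fun σ => ⟨fun τ => by positivity, by simp⟩, fun τ => ?_⟩
  rw [key ν₁ h₁ hs₁, key ν₂ h₂ hs₂]
  simp [eq_comm]

lemma eq_of_agree {J : Finset (Fin n)} (hJ : ∀ k, k ∈ J) {σ τ : G} (h : Agree J σ τ) : σ = τ := by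
  apply Subtype.ext
  have : (σ : Equiv.Perm (Fin n)).symm = (τ : Equiv.Perm (Fin n)).symm :=
    Equiv.ext fun k => h k (hJ k)
  simpa using congrArg Equiv.symm this

/-- The element `σ τ⁻¹` fixes every value above `j`, hence lies in `G_j`, and a trivial orbit forces
it to fix `j`. -/
lemma pos_eq_of_orb_eq {j : Fin n} (h : orb G j = {j}) {σ τ : G}
    (hag : Agree (univ.filter (j < ·)) σ τ) : pos σ j = pos τ j := by
  have hmem : (σ * τ⁻¹ : G).1 ∈ tailStab G j := by
    refine ⟨(σ * τ⁻¹).2, fun k hk => ?_⟩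
    have := hag k (by simp [hk])
    change (σ : Equiv.Perm (Fin n)) (pos τ k) = k
    rw [← this, apply_pos]
  have h2 : (σ * τ⁻¹ : G).1 j ∈ orb G j := ⟨_, hmem, rfl⟩
  rw [h] at h2
  have h3 : (σ : Equiv.Perm (Fin n)) (pos τ j) = j := h2
  exact pos_eq_iff.2 h3

end Swap

/-! ### Transport along the chain of the groups `G_j`. -/

section Chain

variable {n : ℕ} {G : Subgroup (Equiv.Perm (Fin n))}

/-- Transport along the chain of the groups `G_j`: every level `k` moves the mass `V σ k` starting
from `σ`, and each move costs at most `c`. -/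
lemma exists_transport_of_chain {a b : ℝ} (ha : 0 < a) (hb : 0 < b) (hab : 1 / a + 1 / b = 1)
    {d : G → G → ℝ≥0∞} (hd : ∀ σ, d σ σ = 0) (htri : ∀ σ τ ρ, d σ ρ ≤ d σ τ + d τ ρ)
    {c : ℝ≥0∞} {μ : G → ℝ} (hμ : ∀ σ, 0 ≤ μ σ)
    (hS : ∀ j, Swap (fun θ => ∀ σ, d σ (σ * θ) ≤ c) μ (univ.filter (j < ·)) j) (m : ℕ) :
    m ≤ n → ∀ (ρ : G) (ν₁ ν₂ : G → ℝ), IsProb ν₁ → IsProb ν₂ →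
      (∀ σ, ν₁ σ ≠ 0 → restr μ (univ.filter (m ≤ ·.val)) ρ σ ≠ 0) →
      (∀ σ, ν₂ σ ≠ 0 → restr μ (univ.filter (m ≤ ·.val)) ρ σ ≠ 0) →
      ∃ (p : G → G → ℝ) (V : G → Fin n → ℝ), IsTransport p ν₁ ν₂ ∧ (∀ σ k, 0 ≤ V σ k) ∧
        (∀ σ k, V σ k ≠ 0 → k.val < m ∧ orb G k ≠ {k}) ∧
        (∀ σ, ν₁ σ ≠ 0 →
          ∑ τ, ENNReal.ofReal (p σ τ) * d σ τ ≤ c * ENNReal.ofReal (∑ k, V σ k)) ∧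
        ∑ σ, ν₁ σ * ∑ k, V σ k ^ 2 ≤
          2 * (a * relEnt ν₁ (restr μ (univ.filter (m ≤ ·.val)) ρ) +
            b * relEnt ν₂ (restr μ (univ.filter (m ≤ ·.val)) ρ)) ∧
        ∑ k, (∑ σ, ν₁ σ * V σ k) ^ 2 ≤
          (a * relEnt ν₁ (restr μ (univ.filter (m ≤ ·.val)) ρ) +
            b * relEnt ν₂ (restr μ (univ.filter (m ≤ ·.val)) ρ)) / 2 := by
  induction m with
  | zero =>
    intro _ ρ ν₁ ν₂ h₁ h₂ hac₁ hac₂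
    have e₁ := relEnt_nonneg h₁ (restr_nonneg hμ _ _) hac₁
    have e₂ := relEnt_nonneg h₂ (restr_nonneg hμ _ _) hac₂
    refine ⟨_, fun _ _ => 0, isTransport_single ρ h₁ h₂
      (fun σ hσ => eq_of_agree (by simp) (restr_ne_zero.1 (hac₁ σ hσ)).1)
      (fun σ hσ => eq_of_agree (by simp) (restr_ne_zero.1 (hac₂ σ hσ)).1),
      by simp, by simp, fun σ _ => ?_, ?_, ?_⟩
    · rw [sum_eq_single σ (fun τ _ hτ => by simp [hτ]) (by simp)]
      simp [hd]
    · simp only [ne_eq, OfNat.ofNat_ne_zero, not_false_eq_true, zero_pow, sum_const_zero, mul_zero]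
      positivity
    · simp only [mul_zero, sum_const_zero, ne_eq, OfNat.ofNat_ne_zero, not_false_eq_true, zero_pow]
      positivity
  | succ m ih =>
    intro hm ρ ν₁ ν₂ h₁ h₂ hac₁ hac₂
    let j : Fin n := ⟨m, hm⟩
    set J : Finset (Fin n) := univ.filter (m + 1 ≤ ·.val) with hJ
    have hJ' : J = univ.filter (j < ·) := by
      ext k
      simp [hJ, j, Fin.lt_def]
    have hins : insert j J = univ.filter (m ≤ ·.val) := by
      ext k
      simp only [hJ, mem_insert, mem_filter, mem_univ, true_and, j, Fin.ext_iff]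
      omega
    have hSj := hS j
    rw [← hJ'] at hSj
    obtain ⟨θ, hθ1, hΘ, hθ⟩ := hSj.exists_shift ρ
    set x : G → Fin n := fun σ => pos σ j with hx
    set Θ : Fin n → Fin n → G ≃ G := fun i k => Equiv.mulRight (θ i k) with hΘdef
    obtain ⟨q, E₀, hq, hqm, hR, hR', hE, hpos, hq1⟩ :=
      exists_label_transport ha hb hab h₁ h₂ (restr_nonneg hμ J ρ) hac₁ hac₂ hΘ
    have ex₁ : ∀ i, label x ν₁ i ≠ 0 → ∃ σ, x σ = i ∧ restr μ J ρ σ ≠ 0 := fun i hi => by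
      obtain ⟨σ, h, h'⟩ := exists_of_label_ne_zero hi
      exact ⟨σ, h, hac₁ σ h'⟩
    have ex₂ : ∀ i, label x ν₂ i ≠ 0 → ∃ σ, x σ = i ∧ restr μ J ρ σ ≠ 0 := fun i hi => by
      obtain ⟨σ, h, h'⟩ := exists_of_label_ne_zero hi
      exact ⟨σ, h, hac₂ σ h'⟩
    -- Pairs of labels that the coupling does not charge receive the identity transport, so that `P`
    -- and `V` are defined for all pairs.
    have hrec : ∀ i k, ∃ (P : G → G → ℝ) (V : G → Fin n → ℝ), (∀ σ, IsProb (P σ)) ∧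
        (∀ σ l, 0 ≤ V σ l) ∧ (∀ σ l, V σ l ≠ 0 → l.val < m ∧ orb G l ≠ {l}) ∧
        (label x ν₁ i ≠ 0 → q i k ≠ 0 →
          IsTransport P (shiftCond x Θ ν₁ i k) (fiberCond x ν₂ k) ∧
          (∀ σ, shiftCond x Θ ν₁ i k σ ≠ 0 →
            ∑ τ, ENNReal.ofReal (P σ τ) * d σ τ ≤ c * ENNReal.ofReal (∑ l, V σ l)) ∧
          ∑ σ, shiftCond x Θ ν₁ i k σ * ∑ l, V σ l ^ 2 ≤
            2 * (a * relEnt (shiftCond x Θ ν₁ i k) (fiberPart x (restr μ J ρ) k) +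
              b * relEnt (fiberCond x ν₂ k) (fiberPart x (restr μ J ρ) k)) ∧
          ∑ l, (∑ σ, shiftCond x Θ ν₁ i k σ * V σ l) ^ 2 ≤
            (a * relEnt (shiftCond x Θ ν₁ i k) (fiberPart x (restr μ J ρ) k) +
              b * relEnt (fiberCond x ν₂ k) (fiberPart x (restr μ J ρ) k)) / 2) := by
      intro i k
      by_cases hik : label x ν₁ i ≠ 0 ∧ q i k ≠ 0
      · obtain ⟨hi, hk⟩ := hik
        have hk2 := hpos i k hi hk
        obtain ⟨ρ', rfl, hρ'⟩ := ex₂ k hk2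
        have hfib : fiberPart x (restr μ J ρ) (x ρ') = restr μ (univ.filter (m ≤ ·.val)) ρ' := by
          rw [← hins]
          exact fiberPart_restr μ (restr_ne_zero.1 hρ').1
        obtain ⟨P, V, hP, hV, hV', hPd, hs, hs'⟩ := ih (by omega) ρ' (shiftCond x Θ ν₁ i (x ρ'))
          (fiberCond x ν₂ (x ρ')) (isProb_shiftCond h₁.1 hi _) (isProb_fiberCond h₂.1 hk2)
          (fun σ hσ => by rw [← hfib]; exact shiftCond_ac hΘ hac₁ ⟨ρ', rfl, hρ'⟩ σ hσ)
          (fun σ hσ => by rw [← hfib]; exact fiberCond_ac hac₂ σ hσ)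
        rw [← hfib] at hs hs'
        exact ⟨P, V, hP.1, hV, hV', fun _ _ => ⟨hP, hPd, hs, hs'⟩⟩
      · exact ⟨fun σ τ => if τ = σ then 1 else 0, fun _ _ => 0,
          fun σ => ⟨fun τ => by positivity, by simp⟩, by simp, by simp,
          fun h h' => absurd ⟨h, h'⟩ hik⟩
    choose P V hP hV hV' hrec using hrec
    have hVj : ∀ i k σ, V i k σ j = 0 := fun i k σ => by
      by_contra h
      exact (hV' i k σ j h).1.ne rfl
    have hq1le : ∀ i, 0 ≤ 1 - q i i := fun i => by
      have := single_le_sum (fun k _ => (hq i).1 k) (mem_univ i)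
      rw [(hq i).2] at this
      linarith
    -- Level `j` moves the mass that leaves the label; a lower level moves the mean over the new
    -- label of what the transport of the fibre moves there. The fibres move nothing at level `j`,
    -- so the squares have no cross term.
    let V' : G → Fin n → ℝ := fun σ l =>
      ∑ k, q (x σ) k * V (x σ) k (Θ (x σ) k σ) l + if l = j then 1 - q (x σ) (x σ) else 0
    have hV'sq : ∀ σ l, V' σ l ^ 2 ≤ ∑ k, q (x σ) k * V (x σ) k (Θ (x σ) k σ) l ^ 2 +
        if l = j then (1 - q (x σ) (x σ)) ^ 2 else 0 := by
      intro σ l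
      by_cases hl : l = j
      · subst hl
        simp [V', hVj]
      · simp only [V', if_neg hl, add_zero]
        exact (hq _).sum_mul_sq_le _
    refine ⟨glue x Θ q P, V', isTransport_glue h₁ h₂ hq hqm hP
      (fun i k hi hk => (hrec i k hi hk).1), ?_, ?_, ?_, ?_, ?_⟩
    · intro σ l
      refine add_nonneg (sum_nonneg fun k _ => mul_nonneg ((hq _).1 k) (hV _ _ _ _)) ?_
      split_ifs
      exacts [hq1le _, le_rfl]
    · intro σ l hl
      by_cases hlj : l = j
      · refine ⟨by rw [hlj]; exact Nat.lt_succ_self m, fun horb => hl ?_⟩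
        rw [hlj] at horb ⊢
        simp only [V', hVj, mul_zero, sum_const_zero, zero_add, if_true]
        -- For a trivial orbit all charged labels coincide, so the row of a charged label stays put;
        -- for an uncharged label this is the convention `q i i = 1`.
        by_cases hi : label x ν₁ (x σ) = 0
        · rw [hq1 _ hi, sub_self]
        · have : ∀ k, k ≠ x σ → q (x σ) k = 0 := by
            intro k hk
            by_contra hqk
            obtain ⟨σ₁, h1, h1'⟩ := ex₁ _ hi
            obtain ⟨σ₂, h2, h2'⟩ := ex₂ _ (hpos _ _ hi hqk)
            apply hk
            rw [← h1, ← h2]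
            refine pos_eq_of_orb_eq horb fun l hl => ?_
            rw [← hJ'] at hl
            exact ((restr_ne_zero.1 h2').1 l hl).trans ((restr_ne_zero.1 h1').1 l hl).symm
          have h3 := (hq (x σ)).2
          rw [sum_eq_single (x σ) (fun k _ hk => this k hk) (by simp)] at h3
          rw [h3, sub_self]
      · simp only [V', if_neg hlj, add_zero] at hl
        obtain ⟨k, -, hk⟩ := exists_ne_zero_of_sum_ne_zero hl
        have := hV' _ _ _ _ (right_ne_zero_of_mul hk)
        exact ⟨by omega, this.2⟩
    · intro σ hσ
      have hi : label x ν₁ (x σ) ≠ 0 := label_ne_zero h₁.1 hσ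
      have e1 : ∑ τ, ENNReal.ofReal (glue x Θ q P σ τ) * d σ τ =
          ∑ k, ENNReal.ofReal (q (x σ) k) *
            ∑ τ, ENNReal.ofReal (P (x σ) k (Θ (x σ) k σ) τ) * d σ τ := by
        simp only [mul_sum]
        rw [sum_comm]
        refine sum_congr rfl fun τ _ => ?_
        rw [glue, ENNReal.ofReal_sum_of_nonneg
          (fun k _ => mul_nonneg ((hq _).1 k) ((hP _ _ _).1 τ)), sum_mul]
        refine sum_congr rfl fun k _ => ?_
        rw [ENNReal.ofReal_mul ((hq _).1 k), mul_assoc]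
      have e2 : ∑ l, V' σ l = ∑ k, q (x σ) k *
          ((if k = x σ then 0 else 1) + ∑ l, V (x σ) k (Θ (x σ) k σ) l) := by
        simp only [V', mul_add, sum_add_distrib, mul_sum]
        rw [sum_comm, sum_ite_eq' univ j, if_pos (mem_univ _), add_comm]
        congr 1
        simp only [mul_ite, mul_zero, mul_one]
        rw [← (hq (x σ)).2, eq_comm, sub_eq_iff_eq_add.2]
        rw [← sum_erase_add univ _ (mem_univ (x σ))]
        congr 1
        rw [← sum_erase_add univ (fun k => if k = x σ then (0 : ℝ) else q (x σ) k)
          (mem_univ (x σ)), if_pos rfl, add_zero]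
        exact sum_congr rfl fun k hk => by rw [if_neg (ne_of_mem_erase hk)]
      rw [e1, e2, ENNReal.ofReal_sum_of_nonneg (fun k _ => mul_nonneg ((hq _).1 k)
        (add_nonneg (by split_ifs <;> norm_num) (sum_nonneg fun l _ => hV _ _ _ l))), mul_sum]
      refine sum_le_sum fun k _ => ?_
      rw [ENNReal.ofReal_mul ((hq _).1 k), mul_left_comm]
      by_cases hk : q (x σ) k = 0
      · simp [hk]
      refine mul_le_mul_right ?_ _
      have hsh : shiftCond x Θ ν₁ (x σ) k (Θ (x σ) k σ) ≠ 0 := by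
        rw [shiftCond, Equiv.symm_apply_apply, fiberCond]
        exact div_ne_zero (fiberPart_ne_zero_iff.2 ⟨rfl, hσ⟩) hi
      have hdθ : d σ (Θ (x σ) k σ) ≤ c * ENNReal.ofReal (if k = x σ then 0 else 1) := by
        by_cases hkx : k = x σ
        · rw [hkx]
          simp [hΘdef, hθ1, hd]
        · rw [if_neg hkx, ENNReal.ofReal_one, mul_one]
          exact (hθ _ k (Ne.symm hkx) (ex₁ _ hi) (ex₂ _ (hpos _ _ hi hk))).1 σ
      rw [ENNReal.ofReal_add (by split_ifs <;> norm_num) (sum_nonneg fun l _ => hV _ _ _ l),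
        mul_add]
      -- Triangle inequality through the shifted permutation.
      calc ∑ τ, ENNReal.ofReal (P (x σ) k (Θ (x σ) k σ) τ) * d σ τ
          ≤ ∑ τ, (ENNReal.ofReal (P (x σ) k (Θ (x σ) k σ) τ) * d σ (Θ (x σ) k σ) +
            ENNReal.ofReal (P (x σ) k (Θ (x σ) k σ) τ) * d (Θ (x σ) k σ) τ) :=
              sum_le_sum fun τ _ => by
                rw [← mul_add]
                exact mul_le_mul_right (htri _ _ _) _
        _ = d σ (Θ (x σ) k σ) +
            ∑ τ, ENNReal.ofReal (P (x σ) k (Θ (x σ) k σ) τ) * d (Θ (x σ) k σ) τ := by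
              rw [sum_add_distrib, ← sum_mul,
                ← ENNReal.ofReal_sum_of_nonneg (fun τ _ => (hP _ _ _).1 τ), (hP _ _ _).2,
                ENNReal.ofReal_one, one_mul]
        _ ≤ _ := add_le_add hdθ ((hrec _ k hi hk).2.1 _ hsh)
    · calc ∑ σ, ν₁ σ * ∑ l, V' σ l ^ 2
          ≤ ∑ σ, (ν₁ σ * (∑ k, q (x σ) k * ∑ l, V (x σ) k (Θ (x σ) k σ) l ^ 2) +
              ν₁ σ * (1 - q (x σ) (x σ)) ^ 2) := by
            refine sum_le_sum fun σ _ => ?_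
            rw [← mul_add]
            refine mul_le_mul_of_nonneg_left ((sum_le_sum fun l _ => hV'sq σ l).trans
              (le_of_eq ?_)) (h₁.1 σ)
            rw [sum_add_distrib, sum_ite_eq' univ j, if_pos (mem_univ _), sum_comm]
            simp only [mul_sum]
        _ = ∑ i, ∑ k, label x ν₁ i * q i k *
              ∑ σ, shiftCond x Θ ν₁ i k σ * ∑ l, V i k σ l ^ 2 +
            ∑ i, label x ν₁ i * (1 - q i i) ^ 2 := by
            rw [sum_add_distrib, sum_mul_glue h₁.1 q fun i k σ => ∑ l, V i k σ l ^ 2,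
              sum_mul_comp (x := x) (ν := ν₁) fun i => (1 - q i i) ^ 2]
        _ ≤ ∑ i, ∑ k, label x ν₁ i * q i k * (2 *
              (a * relEnt (shiftCond x Θ ν₁ i k) (fiberPart x (restr μ J ρ) k) +
              b * relEnt (fiberCond x ν₂ k) (fiberPart x (restr μ J ρ) k))) + 2 * E₀ := by
            refine add_le_add (sum_le_sum fun i _ => sum_le_sum fun k _ => ?_) hR
            by_cases hi : label x ν₁ i = 0
            · simp [hi]
            by_cases hk : q i k = 0
            · simp [hk]
            exact mul_le_mul_of_nonneg_left (hrec i k hi hk).2.2.1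
              (mul_nonneg (label_nonneg h₁.1 i) ((hq i).1 k))
        _ = _ := by
            rw [← hE, mul_add, add_comm, mul_sum]
            simp only [mul_sum]
            congr 1
            exact sum_congr rfl fun i _ => sum_congr rfl fun k _ => by ring
    -- Jensen's inequality twice, over the old label and over the new one. At level `j` the mean
    -- moved mass appears without loss, which keeps the better constant of Pinsker's inequality.
    · have hmean : ∀ l, (∑ σ, ν₁ σ * V' σ l) ^ 2 ≤
          ∑ i, ∑ k, label x ν₁ i * q i k * (∑ σ, shiftCond x Θ ν₁ i k σ * V i k σ l) ^ 2 +
            if l = j then (∑ i, label x ν₁ i * (1 - q i i)) ^ 2 else 0 := by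
        intro l
        have e : ∑ σ, ν₁ σ * V' σ l =
            ∑ i, label x ν₁ i * ∑ k, q i k * ∑ σ, shiftCond x Θ ν₁ i k σ * V i k σ l +
              if l = j then ∑ i, label x ν₁ i * (1 - q i i) else 0 := by
          simp only [V', mul_add, sum_add_distrib]
          rw [sum_mul_glue h₁.1 q fun i k σ => V i k σ l]
          congr 1
          · refine sum_congr rfl fun i _ => ?_
            rw [mul_sum]
            exact sum_congr rfl fun k _ => by ring
          · split_ifs
            · exact sum_mul_comp (x := x) (ν := ν₁) fun i => 1 - q i i
            · simp
        rw [e]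
        by_cases hl : l = j
        · subst hl
          simp [hVj]
        · simp only [if_neg hl, add_zero]
          refine ((isProb_label h₁).sum_mul_sq_le _).trans (sum_le_sum fun i _ => ?_)
          simp only [mul_assoc]
          rw [← mul_sum]
          exact mul_le_mul_of_nonneg_left ((hq i).sum_mul_sq_le _) (label_nonneg h₁.1 i)
      refine (sum_le_sum fun l _ => hmean l).trans ?_
      rw [sum_add_distrib, sum_ite_eq' univ j, if_pos (mem_univ _), sum_comm]
      calc ∑ i, ∑ l, ∑ k, label x ν₁ i * q i k *
              (∑ σ, shiftCond x Θ ν₁ i k σ * V i k σ l) ^ 2 +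
            (∑ i, label x ν₁ i * (1 - q i i)) ^ 2
          ≤ ∑ i, ∑ k, label x ν₁ i * q i k * ((
              a * relEnt (shiftCond x Θ ν₁ i k) (fiberPart x (restr μ J ρ) k) +
              b * relEnt (fiberCond x ν₂ k) (fiberPart x (restr μ J ρ) k)) / 2) + E₀ / 2 := by
            refine add_le_add (sum_le_sum fun i _ => ?_) hR'
            rw [sum_comm]
            refine sum_le_sum fun k _ => ?_
            rw [← mul_sum]
            by_cases hi : label x ν₁ i = 0
            · simp [hi]
            by_cases hk : q i k = 0
            · simp [hk]
            exact mul_le_mul_of_nonneg_left (hrec i k hi hk).2.2.2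
              (mul_nonneg (label_nonneg h₁.1 i) ((hq i).1 k))
        _ = _ := by
            rw [← hE, add_div, add_comm, sum_div]
            simp only [sum_div]
            congr 1
            exact sum_congr rfl fun i _ => sum_congr rfl fun k _ => by ring

end Chain

/-! ### Pointwise transport with a penalty at a pivot. -/

section Penalized

variable {n : ℕ} {G : Subgroup (Equiv.Perm (Fin n))}

/-- The mass that `p σ` gives to the permutations that differ from `σ` at the position `l`. -/
def applyMove (p : G → G → ℝ) (σ : G) (l : Fin n) : ℝ :=
  ∑ τ : G, if (τ : Equiv.Perm (Fin n)) l ≠ (σ : Equiv.Perm (Fin n)) l then p σ τ else 0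

/-- The mass that `p σ` gives to the permutations in which the value `v` is not where `σ` has
it. -/
def posMove (p : G → G → ℝ) (σ : G) (v : Fin n) : ℝ :=
  ∑ τ : G, if pos τ v ≠ pos σ v then p σ τ else 0

lemma sum_ite_le_one {α : Type*} [Fintype α] {f : α → ℝ} (hf : IsProb f) (A : α → Prop)
    [DecidablePred A] : ∑ x, (if A x then f x else 0) ≤ 1 := by
  rw [← hf.2]
  refine sum_le_sum fun x _ => ?_
  split_ifs
  exacts [le_rfl, hf.1 x]

lemma sum_ite_nonneg {α : Type*} [Fintype α] {f : α → ℝ} (hf : IsProb f) (A : α → Prop)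
    [DecidablePred A] : 0 ≤ ∑ x, (if A x then f x else 0) := by
  refine sum_nonneg fun x _ => ?_
  split_ifs
  exacts [hf.1 x, le_rfl]

lemma IsTransport.ne_zero {α : Type*} [Fintype α] {p : α → α → ℝ} {ν₁ ν₂ : α → ℝ}
    (h : IsTransport p ν₁ ν₂) (hν : ∀ σ, 0 ≤ ν₁ σ) {σ τ : α} (hσ : ν₁ σ ≠ 0) (hp : p σ τ ≠ 0) :
    ν₂ τ ≠ 0 := by
  intro h0
  rw [← h.2 τ] at h0
  have := (sum_eq_zero_iff_of_nonneg fun ρ _ => mul_nonneg (hν ρ) ((h.1 ρ).1 τ)).1 h0 σ (mem_univ _)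
  exact mul_ne_zero hσ hp this

/-- Transport with a penalty at one value `j`, which serves as a pivot: the penalties for the
other points that are moved together with `j` are passed on to the transports of the fibres. -/
lemma exists_transport_pivot {a b : ℝ} (ha : 0 < a) (hb : 0 < b) (hab : 1 / a + 1 / b = 1)
    {s : ℕ} {μ : G → ℝ} (hμ : ∀ σ, 0 ≤ μ σ) {J : Finset (Fin n)} {j : Fin n}
    (hS : Swap (fun θ => deg (θ : Equiv.Perm (Fin n)) ≤ s + 1) μ J j) {ρ : G} {ν₁ ν₂ : G → ℝ}
    (h₁ : IsProb ν₁) (h₂ : IsProb ν₂) (hac₁ : ∀ σ, ν₁ σ ≠ 0 → restr μ J ρ σ ≠ 0)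
    (hac₂ : ∀ σ, ν₂ σ ≠ 0 → restr μ J ρ σ ≠ 0)
    (hrec : ∀ (ρ' : G) (ν₁ ν₂ : G → ℝ), IsProb ν₁ → IsProb ν₂ →
      (∀ σ, ν₁ σ ≠ 0 → restr μ (insert j J) ρ' σ ≠ 0) →
      (∀ σ, ν₂ σ ≠ 0 → restr μ (insert j J) ρ' σ ≠ 0) →
      ∀ w : Fin n → ℝ, (∀ l, 0 ≤ w l) → (∀ k ∈ insert j J, w (pos ρ' k) = 0) →
      ∃ p : G → G → ℝ, IsTransport p ν₁ ν₂ ∧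
        ∑ σ, ν₁ σ * ∑ l, (applyMove p σ l + w l) ^ 2 ≤ 2 * (∑ l, w l) ^ 2 +
          (4 * s ^ 2 + 4) * (a * relEnt ν₁ (restr μ (insert j J) ρ') +
            b * relEnt ν₂ (restr μ (insert j J) ρ')))
    {Y : ℝ} (hY : 0 ≤ Y) :
    ∃ p : G → G → ℝ, IsTransport p ν₁ ν₂ ∧
      ∑ σ, ν₁ σ * ∑ v, (posMove p σ v + if v = j then Y else 0) ^ 2 ≤ 2 * Y ^ 2 +
        (4 * s ^ 2 + 4) * (a * relEnt ν₁ (restr μ J ρ) + b * relEnt ν₂ (restr μ J ρ)) := by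
  classical
  obtain ⟨θ, hθ1, hΘ, hθ⟩ := hS.exists_shift ρ
  set x : G → Fin n := fun σ => pos σ j with hx
  set Θ : Fin n → Fin n → G ≃ G := fun i k => Equiv.mulRight (θ i k) with hΘdef
  obtain ⟨q, E₀, hq, hqm, hR, -, hE, hpos, hq1⟩ :=
    exists_label_transport ha hb hab h₁ h₂ (restr_nonneg hμ J ρ) hac₁ hac₂ hΘ
  have ex₁ : ∀ i, label x ν₁ i ≠ 0 → ∃ σ, x σ = i ∧ restr μ J ρ σ ≠ 0 := fun i hi => by
    obtain ⟨σ, h, h'⟩ := exists_of_label_ne_zero hi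
    exact ⟨σ, h, hac₁ σ h'⟩
  have ex₂ : ∀ i, label x ν₂ i ≠ 0 → ∃ σ, x σ = i ∧ restr μ J ρ σ ≠ 0 := fun i hi => by
    obtain ⟨σ, h, h'⟩ := exists_of_label_ne_zero hi
    exact ⟨σ, h, hac₂ σ h'⟩
  -- The probability that the shift from label `i` moves the point at position `l`, apart from the
  -- pivot itself. It is averaged over `k` before squaring: its total is at most `s (1 - q i i)`,
  -- whose square is covered by Marton's bound.
  let w₀ : Fin n → Fin n → ℝ := fun i l => ∑ k, q i k *
    if k ≠ i ∧ l ∈ (θ i k : Equiv.Perm (Fin n)).support ∧ l ≠ i then 1 else 0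
  have hw₀ : ∀ i l, 0 ≤ w₀ i l := fun i l =>
    sum_nonneg fun k _ => mul_nonneg ((hq i).1 k) (by split_ifs <;> norm_num)
  -- The same penalty read at the positions of the shifted permutation: a value at position `l`
  -- after the shift was at position `θ i k l` before.
  let w : Fin n → Fin n → Fin n → ℝ := fun i k l => w₀ i ((θ i k : Equiv.Perm (Fin n)) l)
  have hwsum : ∀ i k, ∑ l, w i k l = ∑ l, w₀ i l := fun i k =>
    Equiv.sum_comp (θ i k : Equiv.Perm (Fin n)) (w₀ i)
  have hw₀le : ∀ i, label x ν₁ i ≠ 0 → ∑ l, w₀ i l ≤ s * (1 - q i i) := by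
    intro i hi
    have e : (s : ℝ) * (1 - q i i) = ∑ k, q i k * if k ≠ i then (s : ℝ) else 0 := by
      rw [← sum_erase_add univ _ (mem_univ i), if_neg (by simp), mul_zero, add_zero,
        ← (hq i).2, ← sum_erase_add univ (q i) (mem_univ i), add_sub_cancel_right, mul_sum]
      refine sum_congr rfl fun k hk => ?_
      rw [if_pos (ne_of_mem_erase hk), mul_comm]
    rw [e, sum_comm]
    refine sum_le_sum fun k _ => ?_
    rw [← mul_sum]
    by_cases hk : q i k = 0
    · simp [hk]
    refine mul_le_mul_of_nonneg_left ?_ ((hq i).1 k)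
    by_cases hki : k = i
    · simp [hki]
    obtain ⟨hdeg, hθk, -⟩ := hθ i k (Ne.symm hki) (ex₁ i hi) (ex₂ k (hpos i k hi hk))
    rw [if_pos hki]
    -- The position `i` of the pivot is itself moved, which leaves at most `s` other points in a
    -- support of at most `s + 1`.
    have hmem : i ∈ (θ i k : Equiv.Perm (Fin n)).support := by
      rw [Equiv.Perm.mem_support]
      intro h
      exact hki ((θ i k : Equiv.Perm (Fin n)).injective (hθk.trans h.symm))
    have hcard : ((θ i k : Equiv.Perm (Fin n)).support.erase i).card ≤ s := by
      rw [card_erase_of_mem hmem]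
      have : (θ i k : Equiv.Perm (Fin n)).support.card ≤ s + 1 := hdeg
      omega
    have e2 : ∀ l, (if k ≠ i ∧ l ∈ (θ i k : Equiv.Perm (Fin n)).support ∧ l ≠ i then (1 : ℝ)
        else 0) = if l ∈ (θ i k : Equiv.Perm (Fin n)).support.erase i then 1 else 0 := by
      intro l
      refine if_congr ?_ rfl rfl
      rw [mem_erase]
      tauto
    rw [sum_congr rfl fun l _ => e2 l, sum_boole, filter_mem_eq_inter, univ_inter]
    exact_mod_cast hcard
  have hrec' : ∀ i k, ∃ P : G → G → ℝ, (∀ σ, IsProb (P σ)) ∧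
      (label x ν₁ i ≠ 0 → q i k ≠ 0 →
        IsTransport P (shiftCond x Θ ν₁ i k) (fiberCond x ν₂ k) ∧
        ∑ σ, shiftCond x Θ ν₁ i k σ * ∑ l, (applyMove P σ l + w i k l) ^ 2 ≤
          2 * (s * (1 - q i i)) ^ 2 + (4 * s ^ 2 + 4) *
          (a * relEnt (shiftCond x Θ ν₁ i k) (fiberPart x (restr μ J ρ) k) +
            b * relEnt (fiberCond x ν₂ k) (fiberPart x (restr μ J ρ) k))) := by
    intro i k
    by_cases hik : label x ν₁ i ≠ 0 ∧ q i k ≠ 0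
    · obtain ⟨hi, hk⟩ := hik
      have hk2 := hpos i k hi hk
      obtain ⟨ρ', hxρ, hρ'⟩ := ex₂ k hk2
      have hfib : fiberPart x (restr μ J ρ) k = restr μ (insert j J) ρ' := by
        rw [← hxρ]
        exact fiberPart_restr μ (restr_ne_zero.1 hρ').1
      obtain ⟨P, hP, hs⟩ := hrec ρ' (shiftCond x Θ ν₁ i k)
        (fiberCond x ν₂ k) (isProb_shiftCond h₁.1 hi _) (isProb_fiberCond h₂.1 hk2)
        (fun σ hσ => by rw [← hfib]; exact shiftCond_ac hΘ hac₁ ⟨ρ', hxρ, hρ'⟩ σ hσ)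
        (fun σ hσ => by rw [← hfib]; exact fiberCond_ac hac₂ σ hσ) (w i k) (fun l => hw₀ _ _)
        (fun k' hk' => by
          have hθk : (θ i k : Equiv.Perm (Fin n)) k = i := by
            by_cases hki : i = k
            · rw [← hki, hθ1]
              rfl
            · exact (hθ i k hki (ex₁ i hi) (ex₂ k hk2)).2.1
          have hfix : ∀ k, q i k ≠ 0 → ∀ l ∈ J,
              (θ i k : Equiv.Perm (Fin n)) (pos ρ l) = pos ρ l := by
            intro k hk l hl
            by_cases hki : i = k
            · rw [← hki, hθ1]
              rfl
            · exact (hθ i k hki (ex₁ i hi) (ex₂ k (hpos i k hi hk))).2.2 l hl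
          -- The penalty vanishes at positions already fixed: the new position of the pivot pulls
          -- back to `i`, which `w₀` excludes, and no charged shift moves the positions of the
          -- values in `J`.
          refine sum_eq_zero fun m _ => ?_
          by_cases hm : q i m = 0
          · rw [hm, zero_mul]
          rw [if_neg, mul_zero]
          rintro ⟨-, hsupp, hne⟩
          rcases mem_insert.1 hk' with rfl | hk'
          · exact hne ((congrArg _ hxρ).trans hθk)
          · rw [(restr_ne_zero.1 hρ').1 k' hk', hfix k hk k' hk', Equiv.Perm.mem_support] at hsupp
            exact hsupp (hfix m hm k' hk'))
      rw [← hfib, hwsum] at hs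
      refine ⟨P, hP.1, fun _ _ => ⟨hP, hs.trans ?_⟩⟩
      have h0 : 0 ≤ ∑ l, w₀ i l := sum_nonneg fun l _ => hw₀ i l
      have := pow_le_pow_left₀ h0 (hw₀le i hi) 2
      linarith
    · exact ⟨fun σ τ => if τ = σ then 1 else 0, fun σ => ⟨fun τ => by positivity, by simp⟩,
        fun h h' => absurd ⟨h, h'⟩ hik⟩
  choose P hP hPt using hrec'
  have htr : IsTransport (glue x Θ q P) ν₁ ν₂ :=
    isTransport_glue h₁ h₂ hq hqm hP fun i k hi hk => (hPt i k hi hk).1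
  refine ⟨glue x Θ q P, htr, ?_⟩
  have hglue : ∀ σ (A : G → Prop) [DecidablePred A],
      ∑ τ, (if A τ then glue x Θ q P σ τ else 0) =
        ∑ k, q (x σ) k * ∑ τ, if A τ then P (x σ) k (Θ (x σ) k σ) τ else 0 := by
    intro σ A _
    simp only [mul_sum]
    rw [sum_comm]
    refine sum_congr rfl fun τ _ => ?_
    split_ifs
    · rfl
    · simp
  have hpt : ∀ σ, ν₁ σ ≠ 0 →
      ∑ v, (posMove (glue x Θ q P) σ v + if v = j then Y else 0) ^ 2 ≤
        2 * (1 - q (x σ) (x σ)) ^ 2 + 2 * Y ^ 2 + ∑ k, q (x σ) k *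
          ∑ l, (applyMove (P (x σ) k) (Θ (x σ) k σ) l + w (x σ) k l) ^ 2 := by
    intro σ hσ
    have hi : label x ν₁ (x σ) ≠ 0 := label_ne_zero h₁.1 hσ
    have hsh : ∀ k, shiftCond x Θ ν₁ (x σ) k (Θ (x σ) k σ) ≠ 0 := by
      intro k
      rw [shiftCond, Equiv.symm_apply_apply, fiberCond]
      exact div_ne_zero (fiberPart_ne_zero_iff.2 ⟨rfl, hσ⟩) hi
    have hj : posMove (glue x Θ q P) σ j ≤ 1 - q (x σ) (x σ) := by
      rw [posMove, hglue σ]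
      rw [← (hq (x σ)).2, ← sum_erase_add univ (q (x σ)) (mem_univ (x σ)), add_sub_cancel_right,
        ← sum_erase_add univ _ (mem_univ (x σ))]
      -- If the label is kept, the transport stays in the fibre and the pivot does not move.
      have hz : q (x σ) (x σ) * ∑ τ : G, (if pos τ j ≠ pos σ j then
          P (x σ) (x σ) (Θ (x σ) (x σ) σ) τ else 0) = 0 := by
        by_cases hk : q (x σ) (x σ) = 0
        · rw [hk, zero_mul]
        rw [sum_eq_zero, mul_zero]
        intro τ _
        split_ifs with hτ
        · by_contra hP0
          exact hτ (fiberCond_ne_zero ((hPt _ _ hi hk).1.ne_zero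
            (isProb_shiftCond h₁.1 hi _).1 (hsh _) hP0)).1
        · rfl
      rw [hz, add_zero]
      refine sum_le_sum fun k _ => ?_
      exact mul_le_of_le_one_right ((hq _).1 k) (sum_ite_le_one (hP _ _ _) _)
    have hv : ∀ v, v ≠ j → posMove (glue x Θ q P) σ v ≤ ∑ k, q (x σ) k *
        (applyMove (P (x σ) k) (Θ (x σ) k σ) (pos (Θ (x σ) k σ) v) +
          w (x σ) k (pos (Θ (x σ) k σ) v)) := by
      intro v hvj
      have hwl : ∀ k, w (x σ) k (pos (Θ (x σ) k σ) v) = w₀ (x σ) (pos σ v) := by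
        intro k
        change w₀ (x σ) ((θ (x σ) k : Equiv.Perm (Fin n)) (pos (θ (x σ) k) (pos σ v))) = _
        rw [apply_pos]
      have hvi : pos σ v ≠ x σ := fun h => hvj (pos_injective σ h)
      simp only [hwl, mul_add, sum_add_distrib]
      rw [← sum_mul, (hq _).2, one_mul, ← sum_add_distrib, posMove, hglue σ]
      refine sum_le_sum fun k _ => ?_
      rw [← mul_add]
      refine mul_le_mul_of_nonneg_left ?_ ((hq _).1 k)
      -- If the shift moves the value, its move counts as `1` and is covered by the penalty;
      -- otherwise only the transport of the fibre can move it.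
      by_cases hsupp : k ≠ x σ ∧ pos σ v ∈ (θ (x σ) k : Equiv.Perm (Fin n)).support
      · rw [if_pos ⟨hsupp.1, hsupp.2, hvi⟩]
        have h1 := sum_ite_le_one (hP (x σ) k (Θ (x σ) k σ)) fun τ => pos τ v ≠ pos σ v
        have h2 : 0 ≤ applyMove (P (x σ) k) (Θ (x σ) k σ) (pos (Θ (x σ) k σ) v) :=
          sum_ite_nonneg (hP _ _ _) _
        linarith
      · have hfix : pos (Θ (x σ) k σ) v = pos σ v := by
          change pos (θ (x σ) k) (pos σ v) = pos σ v
          by_cases hk : k = x σ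
          · rw [hk, hθ1, pos_one]
          · have : pos σ v ∉ (θ (x σ) k : Equiv.Perm (Fin n)).support := fun h => hsupp ⟨hk, h⟩
            rw [pos_eq_iff]
            exact Equiv.Perm.notMem_support.1 this
        rw [if_neg (by tauto), add_zero, applyMove]
        refine le_of_eq (sum_congr rfl fun τ _ => if_congr ?_ rfl rfl)
        rw [apply_pos, hfix, ne_eq, ne_eq, pos_eq_iff]
    have hnn : ∀ v, 0 ≤ posMove (glue x Θ q P) σ v := fun v => sum_ite_nonneg (htr.1 σ) _
    have hterm : ∀ v, (posMove (glue x Θ q P) σ v + if v = j then Y else 0) ^ 2 ≤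
        (if v = j then 2 * (1 - q (x σ) (x σ)) ^ 2 + 2 * Y ^ 2 else 0) + ∑ k, q (x σ) k *
          (applyMove (P (x σ) k) (Θ (x σ) k σ) (pos (Θ (x σ) k σ) v) +
          w (x σ) k (pos (Θ (x σ) k σ) v)) ^ 2 := by
      intro v
      by_cases hvj : v = j
      · subst hvj
        rw [if_pos rfl, if_pos rfl]
        have h1 : 0 ≤ ∑ k, q (x σ) k *
          (applyMove (P (x σ) k) (Θ (x σ) k σ) (pos (Θ (x σ) k σ) v) +
            w (x σ) k (pos (Θ (x σ) k σ) v)) ^ 2 :=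
          sum_nonneg fun k _ => mul_nonneg ((hq _).1 k) (sq_nonneg _)
        have h2 := pow_le_pow_left₀ (add_nonneg (hnn v) hY) (add_le_add_left hj Y) 2
        nlinarith [sq_nonneg (1 - q (x σ) (x σ) - Y)]
      · rw [if_neg hvj, if_neg hvj, add_zero, zero_add]
        exact (pow_le_pow_left₀ (hnn v) (hv v hvj) 2).trans ((hq _).sum_mul_sq_le _)
    refine (sum_le_sum fun v _ => hterm v).trans (le_of_eq ?_)
    rw [sum_add_distrib, sum_ite_eq' univ j, if_pos (mem_univ _), sum_comm]
    congr 1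
    refine sum_congr rfl fun k _ => ?_
    rw [← mul_sum]
    congr 1
    exact Equiv.sum_comp ((Θ (x σ) k σ : G) : Equiv.Perm (Fin n)).symm
      fun l => (applyMove (P (x σ) k) (Θ (x σ) k σ) l + w (x σ) k l) ^ 2
  calc ∑ σ, ν₁ σ * ∑ v, (posMove (glue x Θ q P) σ v + if v = j then Y else 0) ^ 2
      ≤ ∑ σ, (2 * (ν₁ σ * (1 - q (x σ) (x σ)) ^ 2) + ν₁ σ * (2 * Y ^ 2) +
          ν₁ σ * ∑ k, q (x σ) k *
          ∑ l, (applyMove (P (x σ) k) (Θ (x σ) k σ) l + w (x σ) k l) ^ 2) := by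
        refine sum_le_sum fun σ _ => ?_
        by_cases hσ : ν₁ σ = 0
        · simp [hσ]
        · have := mul_le_mul_of_nonneg_left (hpt σ hσ) (h₁.1 σ)
          linarith
    _ = 2 * ∑ i, label x ν₁ i * (1 - q i i) ^ 2 + 2 * Y ^ 2 +
          ∑ i, ∑ k, label x ν₁ i * q i k * ∑ σ, shiftCond x Θ ν₁ i k σ *
            ∑ l, (applyMove (P i k) σ l + w i k l) ^ 2 := by
        rw [sum_add_distrib, sum_add_distrib, ← mul_sum, ← sum_mul, h₁.2, one_mul,
          sum_mul_glue h₁.1 q fun i k σ => ∑ l, (applyMove (P i k) σ l + w i k l) ^ 2,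
          sum_mul_comp (x := x) (ν := ν₁) fun i => (1 - q i i) ^ 2]
    _ ≤ 2 * ∑ i, label x ν₁ i * (1 - q i i) ^ 2 + 2 * Y ^ 2 +
          ∑ i, ∑ k, label x ν₁ i * q i k * (2 * (s * (1 - q i i)) ^ 2 + (4 * s ^ 2 + 4) *
          (a * relEnt (shiftCond x Θ ν₁ i k) (fiberPart x (restr μ J ρ) k) +
            b * relEnt (fiberCond x ν₂ k) (fiberPart x (restr μ J ρ) k))) := by
        refine add_le_add_right (sum_le_sum fun i _ => sum_le_sum fun k _ => ?_) _
        by_cases hi : label x ν₁ i = 0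
        · simp [hi]
        by_cases hk : q i k = 0
        · simp [hk]
        exact mul_le_mul_of_nonneg_left (hPt i k hi hk).2
          (mul_nonneg (label_nonneg h₁.1 i) ((hq i).1 k))
    _ = (2 + 2 * s ^ 2) * ∑ i, label x ν₁ i * (1 - q i i) ^ 2 + 2 * Y ^ 2 +
          (4 * s ^ 2 + 4) * ∑ i, ∑ k, label x ν₁ i * q i k *
          (a * relEnt (shiftCond x Θ ν₁ i k) (fiberPart x (restr μ J ρ) k) +
            b * relEnt (fiberCond x ν₂ k) (fiberPart x (restr μ J ρ) k)) := by
        have e : ∀ i, ∑ k, label x ν₁ i * q i k * (2 * (s * (1 - q i i)) ^ 2) =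
            2 * s ^ 2 * (label x ν₁ i * (1 - q i i) ^ 2) := by
          intro i
          rw [← sum_mul, ← mul_sum, (hq i).2]
          ring
        simp only [mul_add (label x ν₁ _ * q _ _) (2 * ((s : ℝ) * (1 - q _ _)) ^ 2),
          sum_add_distrib, e, ← mul_sum]
        have e2 : ∀ i k (z : ℝ), label x ν₁ i * q i k * ((4 * s ^ 2 + 4) * z) =
            (4 * s ^ 2 + 4) * (label x ν₁ i * q i k * z) := fun i k z => by ring
        simp only [e2, ← mul_sum]
        ring
    _ ≤ _ := by
        rw [← hE]
        -- Marton's bound turns `2 + 2 s²` into `(4 s² + 4) E₀`, and the chain rule adds this to the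
        -- contribution of the fibres.
        nlinarith [mul_le_mul_of_nonneg_left hR (by positivity : (0 : ℝ) ≤ 2 + 2 * s ^ 2)]

end Penalized

/-! ### Exchange of values and positions, and induction on the free values. -/

section Inversion

variable {n : ℕ} {G : Subgroup (Equiv.Perm (Fin n))}

lemma sum_inv_eq (f : G → ℝ) : ∑ σ : G, f σ⁻¹ = ∑ σ, f σ := Equiv.sum_comp (Equiv.inv G) f

lemma isProb_inv {ν : G → ℝ} (h : IsProb ν) : IsProb fun σ => ν σ⁻¹ :=
  ⟨fun σ => h.1 _, by rw [sum_inv_eq ν, h.2]⟩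

lemma relEnt_inv (ν μ : G → ℝ) : relEnt (fun σ => ν σ⁻¹) (fun σ => μ σ⁻¹) = relEnt ν μ := by
  unfold relEnt
  rw [sum_inv_eq μ, sum_inv_eq fun σ => ν σ * Real.log (ν σ / μ σ)]

lemma isTransport_inv {p : G → G → ℝ} {ν₁ ν₂ : G → ℝ}
    (h : IsTransport p (fun σ => ν₁ σ⁻¹) fun σ => ν₂ σ⁻¹) :
    IsTransport (fun σ τ => p σ⁻¹ τ⁻¹) ν₁ ν₂ := by
  refine ⟨fun σ => ⟨fun τ => (h.1 _).1 _, ?_⟩, fun τ => ?_⟩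
  · rw [sum_inv_eq (p σ⁻¹)]
    exact (h.1 _).2
  · have := h.2 τ⁻¹
    simp only [inv_inv] at this
    rw [← this, ← sum_inv_eq]
    simp

lemma applyMove_inv (p : G → G → ℝ) (σ : G) (l : Fin n) :
    applyMove (fun σ τ => p σ⁻¹ τ⁻¹) σ l = posMove p σ⁻¹ l := by
  unfold applyMove posMove
  rw [← sum_inv_eq fun τ => if pos τ l ≠ pos σ⁻¹ l then p σ⁻¹ τ else 0]
  rfl

/-- Under inversion positions become values, so prescribing the positions of the values in `J`
amounts to prescribing where `σ⁻¹` has the values `pos ρ '' J`. -/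
lemma restr_inv (μ : G → ℝ) (J : Finset (Fin n)) (ρ σ : G) :
    restr (fun σ => μ σ⁻¹) (J.image (pos ρ)) ρ⁻¹ σ⁻¹ = restr μ J ρ σ := by
  have : Agree (J.image (pos ρ)) σ⁻¹ ρ⁻¹ ↔ Agree J σ ρ := by
    simp only [Agree, forall_mem_image]
    refine forall₂_congr fun k _ => ?_
    rw [pos_inv, pos_inv, apply_pos, pos_eq_iff]
  unfold restr
  by_cases h : Agree J σ ρ
  · rw [if_pos h, if_pos (this.2 h)]
    exact congrArg μ (inv_inv σ)
  · rw [if_neg h, if_neg (mt this.1 h)]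

lemma posMove_sum_smul {p : Fin n → G → G → ℝ} (ω : Fin n → ℝ) (σ : G) (v : Fin n) :
    posMove (fun σ τ => ∑ u, ω u * p u σ τ) σ v = ∑ u, ω u * posMove (p u) σ v := by
  simp only [posMove, mul_sum]
  rw [sum_comm]
  refine sum_congr rfl fun τ _ => ?_
  split_ifs
  · rfl
  · simp

lemma isTransport_sum_smul {p : Fin n → G → G → ℝ} {ω : Fin n → ℝ} (hω : IsProb ω) {ν₁ ν₂ : G → ℝ}
    (hp : ∀ u, IsTransport (p u) ν₁ ν₂) :
    IsTransport (fun σ τ => ∑ u, ω u * p u σ τ) ν₁ ν₂ := by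
  refine ⟨fun σ => ⟨fun τ => sum_nonneg fun u _ => mul_nonneg (hω.1 u) (((hp u).1 σ).1 τ), ?_⟩,
    fun τ => ?_⟩
  · rw [sum_comm]
    simp only [← mul_sum, ((hp _).1 σ).2, mul_one, hω.2]
  · simp only [mul_sum]
    rw [sum_comm]
    simp only [mul_left_comm, ← mul_sum, (hp _).2 τ, ← sum_mul, hω.2, one_mul]

/-- A random pivot absorbs a penalty. -/
lemma exists_transport_of_pivots {ν₁ ν₂ : G → ℝ} (h₁ : IsProb ν₁) {J : Finset (Fin n)} {C : ℝ}
    {y : Fin n → ℝ} (hy : ∀ v, 0 ≤ y v) (hyJ : ∀ v ∈ J, y v = 0) {j : Fin n} (hj : j ∉ J)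
    (h : ∀ u, u ∉ J → ∃ p : G → G → ℝ, IsTransport p ν₁ ν₂ ∧
      ∑ σ, ν₁ σ * ∑ v, (posMove p σ v + if v = u then ∑ v, y v else 0) ^ 2 ≤ C) :
    ∃ p : G → G → ℝ, IsTransport p ν₁ ν₂ ∧
      ∑ σ, ν₁ σ * ∑ v, (posMove p σ v + y v) ^ 2 ≤ C := by
  set Y := ∑ v, y v with hYdef
  -- The pivot `u` is drawn with probability `y u / Y`, or is the given `j` when `Y = 0`. The mean
  -- of the point penalties `Y` at `u` is then `y`, and `posMove` is linear in the transport, so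
  -- Jensen's inequality applies to the mixture.
  obtain ⟨ω, hω, hωJ, hωy⟩ : ∃ ω : Fin n → ℝ, IsProb ω ∧ (∀ v ∈ J, ω v = 0) ∧
      ∀ v, y v = ω v * Y := by
    by_cases hY : Y = 0
    · refine ⟨Pi.single j 1, ⟨fun v => ?_, by simp⟩, fun v hv => ?_, fun v => ?_⟩
      · rw [Pi.single_apply]
        positivity
      · exact Pi.single_eq_of_ne (by rintro rfl; exact hj hv) _
      · rw [hY, mul_zero]
        exact (sum_eq_zero_iff_of_nonneg fun v _ => hy v).1 (hYdef.symm.trans hY) v (mem_univ v)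
    · have hY0 : 0 ≤ Y := sum_nonneg fun v _ => hy v
      exact ⟨fun v => y v / Y, ⟨fun v => div_nonneg (hy v) hY0, by rw [← sum_div, div_self hY]⟩,
        fun v hv => by simp [hyJ v hv], fun v => by rw [div_mul_cancel₀ _ hY]⟩
  have h' : ∀ u, ∃ p : G → G → ℝ, IsTransport p ν₁ ν₂ ∧ (u ∉ J →
      ∑ σ, ν₁ σ * ∑ v, (posMove p σ v + if v = u then Y else 0) ^ 2 ≤ C) := by
    intro u
    by_cases hu : u ∈ J
    · obtain ⟨p, hp, -⟩ := h j hj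
      exact ⟨p, hp, fun h => absurd hu h⟩
    · obtain ⟨p, hp, hp'⟩ := h u hu
      exact ⟨p, hp, fun _ => hp'⟩
  choose p hp hpC using h'
  refine ⟨_, isTransport_sum_smul hω hp, ?_⟩
  have hpt : ∀ σ v, (posMove (fun σ τ => ∑ u, ω u * p u σ τ) σ v + y v) ^ 2 ≤
      ∑ u, ω u * (posMove (p u) σ v + if v = u then Y else 0) ^ 2 := by
    intro σ v
    have e : posMove (fun σ τ => ∑ u, ω u * p u σ τ) σ v + y v =
        ∑ u, ω u * (posMove (p u) σ v + if v = u then Y else 0) := by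
      rw [posMove_sum_smul]
      simp only [mul_add, sum_add_distrib, mul_ite, mul_zero]
      rw [sum_ite_eq univ v, if_pos (mem_univ _), hωy]
    rw [e]
    exact hω.sum_mul_sq_le _
  calc _ ≤ ∑ σ, ν₁ σ * ∑ v, ∑ u, ω u * (posMove (p u) σ v + if v = u then Y else 0) ^ 2 :=
        sum_le_sum fun σ _ => mul_le_mul_of_nonneg_left (sum_le_sum fun v _ => hpt σ v) (h₁.1 σ)
    _ = ∑ u, ω u * ∑ σ, ν₁ σ * ∑ v, (posMove (p u) σ v + if v = u then Y else 0) ^ 2 := by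
        simp only [mul_sum]
        rw [sum_congr rfl fun σ _ => sum_comm, sum_comm]
        exact sum_congr rfl fun u _ => sum_congr rfl fun σ _ => sum_congr rfl fun v _ => by ring
    _ ≤ ∑ u, ω u * C := by
        refine sum_le_sum fun u _ => ?_
        by_cases hu : u ∈ J
        · simp [hωJ u hu]
        · exact mul_le_mul_of_nonneg_left (hpC u hu) (hω.1 u)
    _ = C := by rw [← sum_mul, hω.2, one_mul]

/-- Transport with a penalty `y`, for vectors `μ` with shifts at all pivots. -/
theorem exists_transport_penalized {a b : ℝ} (ha : 0 < a) (hb : 0 < b) (hab : 1 / a + 1 / b = 1)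
    (s N : ℕ) : ∀ μ : G → ℝ, (∀ σ, 0 ≤ μ σ) →
      (∀ J j, j ∉ J → Swap (fun θ => deg (θ : Equiv.Perm (Fin n)) ≤ s + 1) μ J j) →
      (∀ J j, j ∉ J →
        Swap (fun θ => deg (θ : Equiv.Perm (Fin n)) ≤ s + 1) (fun σ => μ σ⁻¹) J j) →
      ∀ J : Finset (Fin n), Jᶜ.card = N → ∀ (ρ : G) (ν₁ ν₂ : G → ℝ), IsProb ν₁ → IsProb ν₂ →
      (∀ σ, ν₁ σ ≠ 0 → restr μ J ρ σ ≠ 0) → (∀ σ, ν₂ σ ≠ 0 → restr μ J ρ σ ≠ 0) →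
      ∀ y : Fin n → ℝ, (∀ v, 0 ≤ y v) → (∀ v ∈ J, y v = 0) →
      ∃ p : G → G → ℝ, IsTransport p ν₁ ν₂ ∧
        ∑ σ, ν₁ σ * ∑ v, (posMove p σ v + y v) ^ 2 ≤ 2 * (∑ v, y v) ^ 2 +
          (4 * s ^ 2 + 4) * (a * relEnt ν₁ (restr μ J ρ) + b * relEnt ν₂ (restr μ J ρ)) := by
  induction N with
  | zero =>
    intro μ hμ hS hS' J hJ ρ ν₁ ν₂ h₁ h₂ hac₁ hac₂ y hy hyJ
    have hJ' : ∀ k, k ∈ J := fun k => by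
      rw [card_eq_zero] at hJ
      by_contra hk
      have := mem_compl.2 hk
      simp [hJ] at this
    have e₁ := relEnt_nonneg h₁ (restr_nonneg hμ _ _) hac₁
    have e₂ := relEnt_nonneg h₂ (restr_nonneg hμ _ _) hac₂
    refine ⟨_, isTransport_single ρ h₁ h₂
      (fun σ hσ => eq_of_agree hJ' (restr_ne_zero.1 (hac₁ σ hσ)).1)
      (fun σ hσ => eq_of_agree hJ' (restr_ne_zero.1 (hac₂ σ hσ)).1), ?_⟩
    have hz : ∀ σ v, posMove (fun σ τ : G => if τ = σ then 1 else 0) σ v = 0 := by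
      intro σ v
      refine sum_eq_zero fun τ _ => ?_
      by_cases hτ : τ = σ <;> simp [hτ]
    simp only [hz, hyJ _ (hJ' _), add_zero, ne_eq, OfNat.ofNat_ne_zero, not_false_eq_true,
      zero_pow, sum_const_zero, mul_zero]
    positivity
  | succ N ih =>
    intro μ hμ hS hS' J hJ ρ ν₁ ν₂ h₁ h₂ hac₁ hac₂ y hy hyJ
    obtain ⟨j₀, hj₀⟩ : Jᶜ.Nonempty := card_pos.1 (by omega)
    refine exists_transport_of_pivots h₁ hy hyJ (mem_compl.1 hj₀) fun j hj =>
      exists_transport_pivot ha hb hab hμ (hS J j hj) h₁ h₂ hac₁ hac₂ ?_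
        (sum_nonneg fun v _ => hy v)
    intro ρ' ν₁ ν₂ h₁ h₂ hac₁ hac₂ w hw hwJ
    have hcard : ((insert j J).image (pos ρ'))ᶜ.card = N := by
      rw [card_compl, card_image_of_injective _ (pos_injective ρ'), card_insert_of_notMem hj]
      rw [card_compl] at hJ
      omega
    have hr : ∀ σ, restr (fun σ => μ σ⁻¹) ((insert j J).image (pos ρ')) ρ'⁻¹ σ =
        restr μ (insert j J) ρ' σ⁻¹ := fun σ => by
      have := restr_inv μ (insert j J) ρ' σ⁻¹
      rwa [inv_inv] at this
    -- The penalty left by the pivot sits on positions, which are the values of the inverse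
    -- permutations. The induction therefore alternates between `μ` and its image under inversion,
    -- with one free value fewer.
    obtain ⟨p, hp, hp'⟩ := ih (fun σ => μ σ⁻¹) (fun σ => hμ _) hS'
      (by simpa only [inv_inv] using hS) _ hcard ρ'⁻¹ (fun σ => ν₁ σ⁻¹) (fun σ => ν₂ σ⁻¹)
      (isProb_inv h₁) (isProb_inv h₂) (fun σ hσ => by rw [hr]; exact hac₁ _ hσ)
      (fun σ hσ => by rw [hr]; exact hac₂ _ hσ) w hw (by simpa only [forall_mem_image] using hwJ)
    refine ⟨_, isTransport_inv hp, ?_⟩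
    have hr' : restr (fun σ => μ σ⁻¹) ((insert j J).image (pos ρ')) ρ'⁻¹ =
        fun σ => restr μ (insert j J) ρ' σ⁻¹ := funext hr
    rw [hr', relEnt_inv ν₁, relEnt_inv ν₂] at hp'
    refine le_trans (le_of_eq ?_) hp'
    simp only [applyMove_inv]
    exact (sum_inv_eq fun σ => ν₁ σ⁻¹ * ∑ l, (posMove p σ l + w l) ^ 2).symm.trans
      (by simp only [inv_inv]) |>.symm

/-- The number of moved values equals the number of moved positions. -/
lemma exists_transport_apply {a b : ℝ} (ha : 0 < a) (hb : 0 < b) (hab : 1 / a + 1 / b = 1)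
    {s : ℕ} {μ : G → ℝ} (hμ : ∀ σ, 0 ≤ μ σ)
    (hS : ∀ J j, j ∉ J → Swap (fun θ => deg (θ : Equiv.Perm (Fin n)) ≤ s + 1) μ J j)
    (hS' : ∀ J j, j ∉ J →
      Swap (fun θ => deg (θ : Equiv.Perm (Fin n)) ≤ s + 1) (fun σ => μ σ⁻¹) J j)
    {ν₁ ν₂ : G → ℝ} (h₁ : IsProb ν₁) (h₂ : IsProb ν₂) (hac₁ : ∀ σ, ν₁ σ ≠ 0 → μ σ ≠ 0)
    (hac₂ : ∀ σ, ν₂ σ ≠ 0 → μ σ ≠ 0) :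
    ∃ p : G → G → ℝ, IsTransport p ν₁ ν₂ ∧
      ∑ σ, ν₁ σ * ∑ l, applyMove p σ l ^ 2 ≤
        (4 * s ^ 2 + 4) * (a * relEnt ν₁ μ + b * relEnt ν₂ μ) := by
  have hr : restr μ ∅ 1 = μ := by
    funext σ
    simp [restr, Agree]
  obtain ⟨p, hp, hp'⟩ := exists_transport_penalized ha hb hab s _ μ hμ hS hS' ∅ rfl 1 ν₁ ν₂ h₁ h₂
    (by rwa [hr]) (by rwa [hr]) (fun _ => 0) (fun _ => le_rfl) (fun _ _ => rfl)
  refine ⟨p, hp, ?_⟩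
  rw [hr] at hp'
  simp only [add_zero, sum_const_zero, ne_eq, OfNat.ofNat_ne_zero, not_false_eq_true, zero_pow,
    mul_zero, zero_add] at hp'
  refine le_trans (le_of_eq (sum_congr rfl fun σ _ => ?_)) hp'
  congr 1
  -- The value `σ l` leaves its position exactly when the permutation changes at `l`.
  rw [← Equiv.sum_comp (σ : Equiv.Perm (Fin n)) fun v => posMove p σ v ^ 2]
  refine sum_congr rfl fun l _ => ?_
  congr 1
  refine sum_congr rfl fun τ _ => if_congr ?_ rfl rfl
  rw [pos_apply, ne_eq, ne_eq, pos_eq_iff]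

end Inversion

/-! ### Shifts for local groups, local bases and conjugation invariant measures. -/

section SwapInstances

variable {n ℓ : ℕ} {G : Subgroup (Equiv.Perm (Fin n))}

lemma Swap.mono {Q Q' : G → Prop} {μ : G → ℝ} {J : Finset (Fin n)} {j : Fin n} (h : Swap Q μ J j)
    (hQ : ∀ θ, Q θ → Q' θ) : Swap Q' μ J j := by
  intro σ₁ σ₂ h1 h2 h3
  obtain ⟨θ, hθ, h'⟩ := h σ₁ σ₂ h1 h2 h3
  exact ⟨θ, hQ θ hθ, h'⟩

/-- Constant vectors on a local group. -/
lemma IsLocal.swap (hG : IsLocal ℓ G) {μ : G → ℝ} (hμ : ∀ σ τ, μ σ = μ τ) (J : Finset (Fin n))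
    (j : Fin n) : Swap (fun θ => deg (θ : Equiv.Perm (Fin n)) ≤ ℓ) μ J j := by
  intro σ₁ σ₂ hag _ _
  -- The element `σ₁⁻¹ σ₂` sends `pos σ₂ j` to `pos σ₁ j` and fixes the common positions of the
  -- values in `J`; the support condition passes the latter on to `τ`.
  obtain ⟨τ, hτ, hsupp, hdeg, hτj⟩ := hG (σ₁⁻¹ * σ₂ : G) (σ₁⁻¹ * σ₂ : G).2 (pos σ₂ j) (pos σ₁ j)
    (congrArg (pos σ₁) (apply_pos σ₂ j))
  refine ⟨⟨τ, hτ⟩, hdeg, hτj, fun k hk => ?_, 1, one_pos, fun σ _ _ => by rw [one_mul]; exact hμ _ _⟩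
  have h : pos σ₁ k ∉ (σ₁⁻¹ * σ₂ : G).1.support := by
    rw [Equiv.Perm.notMem_support, hag k hk]
    exact (congrArg (pos σ₁) (apply_pos σ₂ k)).trans (hag k hk)
  exact Equiv.Perm.notMem_support.1 fun h' => h (hsupp h')

lemma deg_conj (σ τ : Equiv.Perm (Fin n)) : deg (σ * τ * σ⁻¹) = deg τ :=
  Equiv.Perm.card_support_conj

lemma deg_inv (σ : Equiv.Perm (Fin n)) : deg σ⁻¹ = deg σ := by
  rw [deg, deg, Equiv.Perm.support_inv]

/-! ### Unique factorization along a local base. -/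

section Base

variable {t : (j : Fin n) → orb G j → G}

/-- The product of the factors before the `j`-th one. -/
def headProd (f : Fin n → G) (j : Fin n) : G := (((List.finRange n).take j).map f).prod

/-- The product of the factors after the `j`-th one. -/
def tailProd (f : Fin n → G) (j : Fin n) : G := (((List.finRange n).drop (j + 1)).map f).prod

lemma prod_ofFn_eq (f : Fin n → G) (j : Fin n) :
    (List.ofFn f).prod = headProd f j * f j * tailProd f j := by
  have h : List.finRange n =
      (List.finRange n).take j ++ j :: (List.finRange n).drop (j + 1) := by
    conv_lhs => rw [← List.take_append_drop j (List.finRange n)]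
    congr 1
    rw [List.drop_eq_getElem_cons (by simp)]
    simp
  rw [List.ofFn_eq_map, h, List.map_append, List.map_cons, List.prod_append, List.prod_cons,
    headProd, tailProd, mul_assoc]

lemma mem_take_finRange {j k : Fin n} (h : k ∈ (List.finRange n).take j) : k < j := by
  obtain ⟨i, hi, rfl⟩ := List.mem_iff_getElem.1 h
  simp only [List.length_take, List.length_finRange, lt_min_iff] at hi
  simpa [Fin.lt_def] using hi.1

lemma mem_drop_finRange {j k : Fin n} (h : k ∈ (List.finRange n).drop (j + 1)) : j < k := by
  obtain ⟨i, hi, rfl⟩ := List.mem_iff_getElem.1 h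
  simp only [List.getElem_drop, List.getElem_finRange, Fin.lt_def, Fin.val_cast]
  omega

lemma headProd_congr {f g : Fin n → G} {j : Fin n} (h : ∀ k < j, f k = g k) :
    headProd f j = headProd g j := by
  rw [headProd, headProd, List.map_congr_left fun k hk => h k (mem_take_finRange hk)]

lemma tailProd_congr {f g : Fin n → G} {j : Fin n} (h : ∀ k, j < k → f k = g k) :
    tailProd f j = tailProd g j := by
  rw [tailProd, tailProd, List.map_congr_left fun k hk => h k (mem_drop_finRange hk)]

lemma IsLocalBase.mem_tailStab (ht : IsLocalBase ℓ G t) (j : Fin n) (i : orb G j) :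
    (t j i : Equiv.Perm (Fin n)) ∈ tailStab G j := by
  by_cases h : (i : Fin n) = j
  · rw [(ht j i).1 h]
    exact (tailStab G j).one_mem
  · exact ((ht j i).2 h).1

lemma IsLocalBase.apply_eq (ht : IsLocalBase ℓ G t) (j : Fin n) (i : orb G j) :
    (t j i : Equiv.Perm (Fin n)) i = j := by
  by_cases h : (i : Fin n) = j
  · rw [(ht j i).1 h, h]
    rfl
  · exact ((ht j i).2 h).2.1

lemma IsLocalBase.deg_le (ht : IsLocalBase ℓ G t) (j : Fin n) (i : orb G j) :
    deg (t j i : Equiv.Perm (Fin n)) ≤ ℓ := by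
  by_cases h : (i : Fin n) = j
  · rw [(ht j i).1 h]
    simp [deg]
  · exact ((ht j i).2 h).2.2

/-- Two nontrivial factors of level `j` both move `j`, so the union of their supports loses at least
one point; a trivial factor leaves at most `ℓ ≤ 2ℓ - 1`. -/
lemma IsLocalBase.deg_inv_mul_le (ht : IsLocalBase ℓ G t) (hℓ : 1 ≤ ℓ) (j : Fin n)
    (i k : orb G j) :
    deg ((t j i)⁻¹ * t j k : Equiv.Perm (Fin n)) ≤ 2 * ℓ - 1 := by
  by_cases hi : (i : Fin n) = j
  · rw [(ht j i).1 hi]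
    have := ht.deg_le j k
    simp only [OneMemClass.coe_one, inv_one, one_mul]
    omega
  by_cases hk : (k : Fin n) = j
  · rw [(ht j k).1 hk]
    have := ht.deg_le j i
    simp only [OneMemClass.coe_one, mul_one, InvMemClass.coe_inv, deg_inv]
    omega
  have hmem : ∀ m : orb G j, (m : Fin n) ≠ j → j ∈ (t j m : Equiv.Perm (Fin n)).support := by
    intro m hm
    rw [Equiv.Perm.mem_support]
    intro h
    exact hm ((t j m : Equiv.Perm (Fin n)).injective ((ht.apply_eq j m).trans h.symm))
  have h1 : ((t j i)⁻¹ * t j k : Equiv.Perm (Fin n)).support ⊆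
      (t j i : Equiv.Perm (Fin n)).support ∪ (t j k : Equiv.Perm (Fin n)).support := by
    refine (Equiv.Perm.support_mul_le _ _).trans ?_
    rw [InvMemClass.coe_inv, Equiv.Perm.support_inv]
    exact le_rfl
  have h2 := card_union_add_card_inter (t j i : Equiv.Perm (Fin n)).support
    (t j k : Equiv.Perm (Fin n)).support
  have h3 : 0 < ((t j i : Equiv.Perm (Fin n)).support ∩
      (t j k : Equiv.Perm (Fin n)).support).card :=
    card_pos.2 ⟨j, mem_inter.2 ⟨hmem i hi, hmem k hk⟩⟩
  have h4 := card_le_card h1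
  have h5 : (t j i : Equiv.Perm (Fin n)).support.card ≤ ℓ := ht.deg_le j i
  have h6 : (t j k : Equiv.Perm (Fin n)).support.card ≤ ℓ := ht.deg_le j k
  rw [deg]
  omega

/-- The factors of `baseMap t i`. -/
def factors (t : (j : Fin n) → orb G j → G) (i : (j : Fin n) → orb G j) (j : Fin n) : G :=
  t j (i j)

/-- Each factor of level `l < j` lies in `G_l` and fixes every `k ≥ j`. The position of such a value
thus depends only on the factors from level `j` on. -/
lemma IsLocalBase.pos_headProd (ht : IsLocalBase ℓ G t) (i : (j : Fin n) → orb G j) {j k : Fin n}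
    (h : j ≤ k) : pos (headProd (factors t i) j) k = k := by
  have : (headProd (factors t i) j : Equiv.Perm (Fin n)) k = k := by
    rw [headProd]
    have hmem : ∀ l ∈ (List.finRange n).take j, (factors t i l : Equiv.Perm (Fin n)) k = k :=
      fun l hl => (ht.mem_tailStab l (i l)).2 k ((mem_take_finRange hl).trans_le h)
    generalize (List.finRange n).take j = L at hmem
    induction L with
    | nil => rfl
    | cons a L ih =>
      rw [List.map_cons, List.prod_cons]
      change (factors t i a : Equiv.Perm (Fin n)) (((L.map (factors t i)).prod : G).1 k) = k
      rw [ih fun l hl => hmem l (List.mem_cons_of_mem _ hl), hmem a List.mem_cons_self]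
  exact pos_eq_iff.2 this

lemma IsLocalBase.pos_factor (ht : IsLocalBase ℓ G t) (j : Fin n) (i : orb G j) :
    pos (t j i) j = i := pos_eq_iff.2 (ht.apply_eq j i)

lemma IsLocalBase.pos_factor_of_lt (ht : IsLocalBase ℓ G t) {j k : Fin n} (i : orb G j)
    (h : j < k) : pos (t j i) k = k := pos_eq_iff.2 ((ht.mem_tailStab j i).2 k h)

lemma baseMap_eq (t : (j : Fin n) → orb G j → G) (i : (j : Fin n) → orb G j) (j : Fin n) :
    baseMap t i = headProd (factors t i) j * t j (i j) * tailProd (factors t i) j :=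
  prod_ofFn_eq (factors t i) j

lemma IsLocalBase.pos_baseMap (ht : IsLocalBase ℓ G t) (i : (j : Fin n) → orb G j) (j : Fin n) :
    pos (baseMap t i) j = pos (tailProd (factors t i) j) (i j) := by
  rw [baseMap_eq t i j, pos_mul, pos_mul, ht.pos_headProd i le_rfl, ht.pos_factor]

lemma IsLocalBase.pos_baseMap_of_lt (ht : IsLocalBase ℓ G t) (i : (j : Fin n) → orb G j)
    {j k : Fin n} (h : j < k) : pos (baseMap t i) k = pos (tailProd (factors t i) j) k := by
  rw [baseMap_eq t i j, pos_mul, pos_mul, ht.pos_headProd i h.le, ht.pos_factor_of_lt _ h]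

/-- The coordinates `i k` with `j ≤ k` can be read off from the positions of these values. -/
lemma IsLocalBase.eq_of_pos_eq (ht : IsLocalBase ℓ G t) {i i' : (j : Fin n) → orb G j} {j : Fin n}
    (h : ∀ k, j ≤ k → pos (baseMap t i) k = pos (baseMap t i') k) (k : Fin n) (hk : j ≤ k) :
    i k = i' k := by
  -- Downward induction: once the later factors agree, the position of `k` determines `i k`.
  induction k using WellFoundedGT.induction with
  | ind k ih =>
    have h1 := h k hk
    have h2 : tailProd (factors t i) k = tailProd (factors t i') k :=
      tailProd_congr fun l hl => by rw [factors, factors, ih l hl (hk.trans hl.le)]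
    rw [ht.pos_baseMap, ht.pos_baseMap, h2] at h1
    exact Subtype.ext (pos_injective _ h1)

lemma IsLocalBase.injective_baseMap (ht : IsLocalBase ℓ G t) :
    Function.Injective (baseMap t) := fun i i' h =>
  funext fun k => ht.eq_of_pos_eq (j := k) (fun l _ => by rw [h]) k le_rfl

lemma baseMap_update (t : (j : Fin n) → orb G j → G) (i : (j : Fin n) → orb G j) (j : Fin n)
    (k : orb G j) : baseMap t (Function.update i j k) =
      headProd (factors t i) j * t j k * tailProd (factors t i) j := by
  rw [baseMap_eq t _ j, Function.update_self,
    headProd_congr (g := factors t i) fun l hl => by rw [factors, factors,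
      Function.update_of_ne hl.ne],
    tailProd_congr (g := factors t i) fun l hl => by rw [factors, factors,
      Function.update_of_ne hl.ne']]

lemma IsLocalBase.real_map_baseMap (ht : IsLocalBase ℓ G t) (ν : (j : Fin n) → Measure (orb G j))
    [∀ j, IsProbabilityMeasure (ν j)] (i : (j : Fin n) → orb G j) :
    ((Measure.pi ν).map (baseMap t)).real {baseMap t i} = ∏ j, (ν j).real {i j} := by
  have hm : Measurable (baseMap t) := Measurable.of_discrete
  rw [measureReal_def, Measure.map_apply hm (measurableSet_singleton _),
    ← Set.image_singleton, ht.injective_baseMap.preimage_image, Measure.pi_singleton,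
    ENNReal.toReal_prod]
  rfl

lemma real_map_baseMap_eq_zero (ν : (j : Fin n) → Measure (orb G j)) {σ : G}
    (hσ : ∀ i, baseMap t i ≠ σ) : ((Measure.pi ν).map (baseMap t)).real {σ} = 0 := by
  have hm : Measurable (baseMap t) := Measurable.of_discrete
  rw [measureReal_def, Measure.map_apply hm (measurableSet_singleton _)]
  have : baseMap t ⁻¹' {σ} = ∅ := Set.eq_empty_of_forall_notMem fun i hi => hσ i hi
  rw [this, measure_empty, ENNReal.toReal_zero]

/-- Measures of the class attached to a local base have shifts along the chain of the `G_j`. -/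
lemma IsLocalBase.swap (ht : IsLocalBase ℓ G t) (hℓ : 1 ≤ ℓ) {μ : Measure G}
    (hμ : μ ∈ measureClass t) (j : Fin n) :
    Swap (fun θ : G => deg (θ : Equiv.Perm (Fin n)) ≤ 2 * ℓ - 1 ∧
      ∃ g₁ g₂ : G, deg (g₁ : Equiv.Perm (Fin n)) ≤ ℓ ∧ deg (g₂ : Equiv.Perm (Fin n)) ≤ ℓ ∧
        θ = g₁ * g₂) (fun σ => μ.real {σ}) (univ.filter (j < ·)) j := by
  obtain ⟨ν, hν, rfl⟩ := hμ
  intro σ₁ σ₂ hag h₁ h₂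
  obtain ⟨i₁, rfl⟩ : ∃ i, baseMap t i = σ₁ := by
    by_contra! h
    exact h₁ (real_map_baseMap_eq_zero ν h)
  obtain ⟨i₂, rfl⟩ : ∃ i, baseMap t i = σ₂ := by
    by_contra! h
    exact h₂ (real_map_baseMap_eq_zero ν h)
  simp only [Agree, mem_filter, mem_univ, true_and] at hag
  have heq : ∀ i i' : (j : Fin n) → orb G j,
      (∀ k, j < k → pos (baseMap t i) k = pos (baseMap t i') k) →
      tailProd (factors t i) j = tailProd (factors t i') j := by
    intro i i' h
    refine tailProd_congr fun k hk => ?_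
    rw [factors, factors, ht.eq_of_pos_eq (j := k) (fun l hl => h l (hk.trans_le hl)) k le_rfl]
  set B := tailProd (factors t i₁) j with hB
  have hB₂ : tailProd (factors t i₂) j = B := (heq i₁ i₂ hag).symm
  have hp₁ : pos (baseMap t i₁) j = pos B (i₁ j) := ht.pos_baseMap i₁ j
  have hp₂ : pos (baseMap t i₂) j = pos B (i₂ j) := by rw [ht.pos_baseMap, hB₂]
  simp only [ht.real_map_baseMap] at h₁ h₂
  have hν₁ : 0 < (ν j).real {i₁ j} :=
    measureReal_nonneg.lt_of_ne' (prod_ne_zero_iff.1 h₁ j (mem_univ j))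
  have hν₂ : 0 < (ν j).real {i₂ j} :=
    measureReal_nonneg.lt_of_ne' (prod_ne_zero_iff.1 h₂ j (mem_univ j))
  -- Right multiplication by `θ` exchanges the factor of level `j`. On the fibre `B` is constant, so
  -- one `θ` serves all of it, and the product weights change by the ratio of the weights of `i₂ j`
  -- and `i₁ j`.
  set θ : G := B⁻¹ * (t j (i₁ j))⁻¹ * t j (i₂ j) * B with hθ
  have hθj : pos θ (pos B (i₁ j)) = pos B (i₂ j) := by
    have : pos θ (pos B (i₁ j)) = pos B (pos (t j (i₂ j)) ((t j (i₁ j) : Equiv.Perm (Fin n))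
      ((B : Equiv.Perm (Fin n)) (pos B (i₁ j))))) := rfl
    rw [this, apply_pos, ht.apply_eq, ht.pos_factor]
  have hθk : ∀ k, j < k → pos θ (pos B k) = pos B k := by
    intro k hk
    have : pos θ (pos B k) = pos B (pos (t j (i₂ j)) ((t j (i₁ j) : Equiv.Perm (Fin n))
      ((B : Equiv.Perm (Fin n)) (pos B k)))) := rfl
    rw [this, apply_pos, (ht.mem_tailStab j (i₁ j)).2 k hk, ht.pos_factor_of_lt _ hk]
  refine ⟨θ, ⟨?_, B⁻¹ * (t j (i₁ j))⁻¹ * B, B⁻¹ * t j (i₂ j) * B, ?_, ?_, ?_⟩, ?_, ?_,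
    (ν j).real {i₂ j} / (ν j).real {i₁ j}, div_pos hν₂ hν₁, ?_⟩
  · have e : (θ : Equiv.Perm (Fin n)) =
        (B : Equiv.Perm (Fin n))⁻¹ * ((t j (i₁ j))⁻¹ * t j (i₂ j)) * (B : Equiv.Perm (Fin n))⁻¹⁻¹ := by
      simp [hθ, mul_assoc]
    rw [e, deg_conj]
    exact ht.deg_inv_mul_le hℓ j _ _
  · have e : ((B⁻¹ * (t j (i₁ j))⁻¹ * B : G) : Equiv.Perm (Fin n)) =
        (B : Equiv.Perm (Fin n))⁻¹ * (t j (i₁ j) : Equiv.Perm (Fin n))⁻¹ *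
          (B : Equiv.Perm (Fin n))⁻¹⁻¹ := by simp
    rw [e, deg_conj, deg_inv]
    exact ht.deg_le _ _
  · have e : ((B⁻¹ * t j (i₂ j) * B : G) : Equiv.Perm (Fin n)) =
        (B : Equiv.Perm (Fin n))⁻¹ * (t j (i₂ j) : Equiv.Perm (Fin n)) *
          (B : Equiv.Perm (Fin n))⁻¹⁻¹ := by simp
    rw [e, deg_conj]
    exact ht.deg_le _ _
  · rw [hθ]
    group
  · rw [hp₁, hp₂, ← hθj, apply_pos]
  · intro k hk
    rw [mem_filter] at hk
    rw [ht.pos_baseMap_of_lt i₁ hk.2, ← pos_eq_iff]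
    exact hθk k hk.2
  · intro σ hσ hσj
    simp only [Agree, mem_filter, mem_univ, true_and] at hσ
    by_cases hex : ∃ i, baseMap t i = σ
    · obtain ⟨i, rfl⟩ := hex
      have hij : i j = i₁ j := ht.eq_of_pos_eq (j := j) (fun k hk => by
        rcases hk.eq_or_lt with rfl | hk
        exacts [hσj, hσ k hk]) j le_rfl
      have e : baseMap t i * θ = baseMap t (Function.update i j (i₂ j)) := by
        rw [baseMap_update, baseMap_eq t i j, heq i i₁ hσ, ← hB, hij, hθ]
        group
      simp only [e, ht.real_map_baseMap]
      rw [← mul_prod_erase univ _ (mem_univ j), ← mul_prod_erase univ _ (mem_univ j),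
        Function.update_self, hij, ← mul_assoc, div_mul_cancel₀ _ hν₁.ne']
      congr 1
      refine prod_congr rfl fun k hk => ?_
      rw [Function.update_of_ne (ne_of_mem_erase hk)]
    -- Surjectivity of `baseMap t` is not needed: if `σ` is not in the range then neither is `σ *
    -- θ`, and both sides are zero.
    · have h0 : ∀ i, baseMap t i ≠ σ := fun i hi => hex ⟨i, hi⟩
      have h0' : ∀ i, baseMap t i ≠ σ * θ := by
        intro i hi
        have hk : ∀ k, j < k → pos (baseMap t i) k = pos (baseMap t i₁) k := by
          intro k hk
          rw [hi, pos_mul, hσ k hk, ht.pos_baseMap_of_lt i₁ hk]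
          exact hθk k hk
        have hij : i j = i₂ j := ht.eq_of_pos_eq (j := j) (fun k hk' => by
          rcases hk'.eq_or_lt with rfl | hk'
          · rw [hi, pos_mul, hσj, hp₁, hp₂]
            exact hθj
          · rw [hk k hk', hag k hk']) j le_rfl
        refine h0 (Function.update i j (i₁ j)) ?_
        rw [baseMap_update, ← mul_inv_eq_iff_eq_mul.2 hi, baseMap_eq t i j, heq i i₁ hk, ← hB, hij, hθ]
        group
      simp only [real_map_baseMap_eq_zero ν h0, real_map_baseMap_eq_zero ν h0', mul_zero]

end Base

/-- With `m = n - 1 - #J` there are `#J` points above `m`, and any bijection of them with `J`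
extends. A final transposition of two points outside `J` sends `m` to `j`. Relabelling by `s` turns
an arbitrary pivot into a step of the chain. -/
lemma exists_perm_of_notMem {J : Finset (Fin n)} {j : Fin n} (hj : j ∉ J) :
    ∃ (s : Equiv.Perm (Fin n)) (m : Fin n), s m = j ∧ ∀ k, s k ∈ J ↔ m < k := by
  have hcard : J.card < n := by
    have := card_lt_card (ssubset_univ_iff.2 fun h : J = univ => hj (h ▸ mem_univ j))
    simpa using this
  let m : Fin n := ⟨n - 1 - J.card, by omega⟩
  have hm : Fintype.card {k // m < k} = Fintype.card {k // k ∈ J} := by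
    rw [Fintype.card_coe, Fintype.card_subtype]
    have : (univ.filter (m < ·)) = Ioi m := by ext; simp
    rw [this, Fin.card_Ioi]
    simp only [m]
    omega
  let e := Fintype.equivOfCardEq hm
  let s₀ := e.extendSubtype
  have hs₀ : ∀ k, s₀ k ∈ J ↔ m < k := by
    intro k
    by_cases hk : m < k
    · exact iff_of_true (e.extendSubtype_mem k hk) hk
    · exact iff_of_false (e.extendSubtype_not_mem k hk) hk
  refine ⟨Equiv.swap (s₀ m) j * s₀, m, by simp, fun k => ?_⟩
  rw [Equiv.Perm.mul_apply]
  by_cases h1 : s₀ k = s₀ m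
  · rw [h1, Equiv.swap_apply_left, s₀.injective h1]
    simp [hj]
  by_cases h2 : s₀ k = j
  · rw [h2, Equiv.swap_apply_right, hs₀, ← hs₀ k, h2]
    simp [hj]
  · rw [Equiv.swap_apply_of_ne_of_ne h1 h2, hs₀]

/-- A conjugation invariant vector with shifts along one chain has shifts along all chains. -/
lemma swap_of_conj_invariant {K : ℕ} (hG : G.Normal) {μ : G → ℝ}
    (hμ : ∀ (σ τ : G) (s : Equiv.Perm (Fin n)),
      (τ : Equiv.Perm (Fin n)) = s⁻¹ * (σ : Equiv.Perm (Fin n)) * s → μ σ = μ τ)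
    (h : ∀ j, Swap (fun θ : G => deg (θ : Equiv.Perm (Fin n)) ≤ K) μ (univ.filter (j < ·)) j)
    (J : Finset (Fin n)) (j : Fin n) (hj : j ∉ J) :
    Swap (fun θ : G => deg (θ : Equiv.Perm (Fin n)) ≤ K) μ J j := by
  obtain ⟨s, m, rfl, hs⟩ := exists_perm_of_notMem hj
  let c : G → G := fun σ => ⟨s⁻¹ * σ * s, by simpa using hG.conj_mem σ σ.2 s⁻¹⟩
  have hc : ∀ σ, μ (c σ) = μ σ := fun σ => (hμ σ (c σ) s rfl).symm
  have hpos : ∀ σ k, s (pos (c σ) k) = pos σ (s k) := fun σ k => by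
    have : pos (c σ) k = s⁻¹ (pos σ (s k)) := rfl
    rw [this]
    simp
  have hJ : ∀ k ∈ J, ∃ l, m < l ∧ s l = k := fun k hk =>
    ⟨s⁻¹ k, (hs _).1 (by simpa using hk), by simp⟩
  have hag : ∀ σ τ : G, Agree J σ τ → Agree (univ.filter (m < ·)) (c σ) (c τ) := by
    intro σ τ hστ k hk
    apply s.injective
    rw [hpos, hpos]
    exact hστ _ ((hs k).2 (mem_filter.1 hk).2)
  intro σ₁ σ₂ h12 h1 h2
  obtain ⟨θ, hdeg, hθ, hfix, κ, hκ, hκ'⟩ := h m (c σ₁) (c σ₂) (hag _ _ h12) (by rwa [hc])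
    (by rwa [hc])
  refine ⟨⟨s * θ * s⁻¹, hG.conj_mem θ θ.2 s⟩, by simpa only [deg_conj] using hdeg, ?_, ?_, κ, hκ, ?_⟩
  · change s (θ.1 (s⁻¹ (pos σ₂ (s m)))) = _
    rw [← hpos, Equiv.Perm.inv_def, Equiv.symm_apply_apply, hθ, hpos]
  · intro k hk
    obtain ⟨l, hl, rfl⟩ := hJ k hk
    change s (θ.1 (s⁻¹ (pos σ₁ (s l)))) = _
    rw [← hpos, Equiv.Perm.inv_def, Equiv.symm_apply_apply, hfix l (by simpa using hl)]
  · intro σ hσ hσj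
    have e : c (σ * ⟨s * θ * s⁻¹, hG.conj_mem θ θ.2 s⟩) = c σ * θ := by
      apply Subtype.ext
      simp [c, mul_assoc]
    rw [← hc, e, hκ' (c σ) (hag _ _ hσ) (s.injective (by rw [hpos, hpos, hσj])), hc]

end SwapInstances

/-! ### From measures and kernels to vectors and matrices. -/

section FiniteMeasure

variable {α : Type*} [Fintype α] [MeasurableSpace α] [MeasurableSingletonClass α]

lemma isProb_real (ν : Measure α) [IsProbabilityMeasure ν] : IsProb fun x => ν.real {x} := by
  refine ⟨fun _ => measureReal_nonneg, ?_⟩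
  rw [sum_measureReal_singleton, coe_univ, probReal_univ]

lemma real_ne_zero_of_ac {α : Type*} [MeasurableSpace α] {ν μ : Measure α} [IsFiniteMeasure ν] [IsFiniteMeasure μ] (h : ν ≪ μ)
    (x : α) (hx : ν.real {x} ≠ 0) : μ.real {x} ≠ 0 := by
  rw [measureReal_ne_zero_iff] at hx ⊢
  exact fun h0 => hx (h h0)

lemma klDiv_eq_ofReal_relEnt {ν μ : Measure α} [IsProbabilityMeasure ν] [IsProbabilityMeasure μ]
    (h : ν ≪ μ) :
    klDiv ν μ = ENNReal.ofReal (relEnt (fun x => ν.real {x}) fun x => μ.real {x}) := by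
  have hμ := isProb_real μ
  rw [klDiv_eq_lintegral_klFun_of_ac h, lintegral_fintype,
    relEnt_eq_sum_klFun (isProb_real ν) hμ.1 (real_ne_zero_of_ac h), hμ.2,
    ENNReal.ofReal_sum_of_nonneg fun x _ => by
      have := klFun_nonneg (div_nonneg (measureReal_nonneg (μ := ν) (s := {x}))
        (div_nonneg (measureReal_nonneg (μ := μ) (s := {x})) zero_le_one))
      have := measureReal_nonneg (μ := μ) (s := {x})
      positivity]
  refine sum_congr rfl fun x _ => ?_
  rw [div_one, ENNReal.ofReal_mul measureReal_nonneg, ofReal_measureReal, mul_comm]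
  -- At atoms of `μ` the Radon–Nikodym derivative is the quotient of the masses; elsewhere its value
  -- does not matter.
  by_cases hx : μ {x} = 0
  · rw [hx, zero_mul, zero_mul]
  · have h1 : ν {x} = ν.rnDeriv μ x * μ {x} := by
      conv_lhs => rw [← Measure.withDensity_rnDeriv_eq ν μ h]
      rw [withDensity_apply _ (measurableSet_singleton x), lintegral_singleton]
    rw [measureReal_def, measureReal_def, ← ENNReal.toReal_div, h1,
      ENNReal.mul_div_cancel_right hx (measure_ne_top μ _)]

/-- The kernel with transition matrix `p`. -/
def matrixKernel (p : α → α → ℝ) : Kernel α α :=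
  Kernel.ofFunOfCountable fun x => ∑ y, ENNReal.ofReal (p x y) • Measure.dirac y

lemma matrixKernel_apply (p : α → α → ℝ) (x : α) :
    matrixKernel p x = ∑ y, ENNReal.ofReal (p x y) • Measure.dirac y := rfl

lemma lintegral_matrixKernel (p : α → α → ℝ) (x : α) (f : α → ℝ≥0∞) :
    ∫⁻ y, f y ∂(matrixKernel p x) = ∑ y, ENNReal.ofReal (p x y) * f y := by
  rw [matrixKernel_apply, lintegral_finsetSum_measure]
  refine sum_congr rfl fun y _ => ?_
  rw [lintegral_smul_measure, lintegral_dirac, smul_eq_mul]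

lemma matrixKernel_apply_setOf {p : α → α → ℝ} {x : α} (hp : ∀ y, 0 ≤ p x y) (A : α → Prop)
    [DecidablePred A] :
    matrixKernel p x {y | A y} = ENNReal.ofReal (∑ y, if A y then p x y else 0) := by
  rw [← lintegral_indicator_one (Set.toFinite {y | A y}).measurableSet, lintegral_matrixKernel,
    ENNReal.ofReal_sum_of_nonneg fun y _ => by split_ifs; exacts [hp y, le_rfl]]
  refine sum_congr rfl fun y _ => ?_
  by_cases h : A y <;> simp [h]

lemma IsTransport.isMarkovKernel {p : α → α → ℝ} {ν₁ ν₂ : α → ℝ} (hp : IsTransport p ν₁ ν₂) :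
    IsMarkovKernel (matrixKernel p) := by
  refine ⟨fun x => ⟨?_⟩⟩
  have := matrixKernel_apply_setOf (hp.1 x).1 fun _ => True
  simpa [(hp.1 x).2] using this

lemma IsTransport.snd_compProd {p : α → α → ℝ} {ν₁ ν₂ : Measure α} [IsProbabilityMeasure ν₁]
    [IsProbabilityMeasure ν₂]
    (hp : IsTransport p (fun x => ν₁.real {x}) fun x => ν₂.real {x}) :
    (ν₁ ⊗ₘ matrixKernel p).snd = ν₂ := by
  have := hp.isMarkovKernel
  rw [Measure.snd_compProd]
  refine Measure.ext_of_singleton fun y => ?_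
  classical
  have h2 : ∑ x, ν₁.real {x} * p x y = ν₂.real {y} := hp.2 y
  rw [Measure.bind_apply (measurableSet_singleton y) (matrixKernel p).aemeasurable,
    lintegral_fintype, ← ofReal_measureReal (μ := ν₂), ← h2, ENNReal.ofReal_sum_of_nonneg
      fun x _ => mul_nonneg measureReal_nonneg ((hp.1 x).1 y)]
  refine sum_congr rfl fun x _ => ?_
  have := matrixKernel_apply_setOf (hp.1 x).1 fun z => z = y
  rw [Set.ofPred_eq_eq_singleton] at this
  rw [this, ENNReal.ofReal_mul measureReal_nonneg, ofReal_measureReal, mul_comm]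
  simp

end FiniteMeasure

/-! ### Optimization over conjugate exponents. -/

section Optimization

/-- Optimization over conjugate exponents. -/
lemma le_mul_sqrt_add_sqrt_sq {T C : ℝ≥0∞} (hC : C ≠ ∞) {x y : ℝ} (hx : 0 ≤ x) (hy : 0 ≤ y)
    (h : ∀ a b : ℝ, 0 < a → 0 < b → 1 / a + 1 / b = 1 → T ≤ C * ENNReal.ofReal (a * x + b * y)) :
    T ≤ C * (ENNReal.ofReal x ^ (1 / 2 : ℝ) + ENNReal.ofReal y ^ (1 / 2 : ℝ)) ^ 2 := by
  rw [ENNReal.ofReal_rpow_of_nonneg hx (by norm_num), ENNReal.ofReal_rpow_of_nonneg hy (by norm_num),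
    ← Real.sqrt_eq_rpow, ← Real.sqrt_eq_rpow,
    ← ENNReal.ofReal_add (Real.sqrt_nonneg _) (Real.sqrt_nonneg _),
    ← ENNReal.ofReal_pow (add_nonneg (Real.sqrt_nonneg _) (Real.sqrt_nonneg _))]
  -- The optimal exponents are `(√x + √y) / √x` and `(√x + √y) / √y`; adding `ε` to each root keeps
  -- them defined when an entropy vanishes.
  have key : ∀ ε : ℝ, 0 < ε → T ≤ C * ENNReal.ofReal ((√x + √y + 2 * ε) ^ 2) := by
    intro ε hε
    have hu : 0 < √x + ε := by positivity
    have hv : 0 < √y + ε := by positivity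
    refine (h ((√x + √y + 2 * ε) / (√x + ε)) ((√x + √y + 2 * ε) / (√y + ε)) (by positivity)
      (by positivity) ?_).trans (mul_le_mul_right (ENNReal.ofReal_le_ofReal ?_) C)
    · have : √x + √y + 2 * ε ≠ 0 := by positivity
      field_simp
      ring
    · have e : ∀ z : ℝ, 0 ≤ z → z / (√z + ε) ≤ √z + ε := by
        intro z hz
        rw [div_le_iff₀ (by positivity)]
        nlinarith [Real.sq_sqrt hz, Real.sqrt_nonneg z]
      have := mul_le_mul_of_nonneg_left (add_le_add (e x hx) (e y hy))
        (by positivity : 0 ≤ √x + √y + 2 * ε)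
      calc _ = (√x + √y + 2 * ε) * (x / (√x + ε) + y / (√y + ε)) := by ring
        _ ≤ _ := this
        _ = _ := by ring
  have hc : Continuous fun ε : ℝ => (√x + √y + 2 * ε) ^ 2 := by fun_prop
  have ht := ENNReal.Tendsto.const_mul (a := C) (ENNReal.tendsto_ofReal
    ((hc.tendsto 0).mono_left (nhdsWithin_le_nhds (s := Set.Ioi 0)))) (Or.inr hC)
  rw [mul_zero, add_zero] at ht
  exact ge_of_tendsto ht (eventually_nhdsWithin_of_forall key)

end Optimization

/-! ### Upper bounds for the costs by explicit transports. -/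

section Cost

variable {n : ℕ} {G : Subgroup (Equiv.Perm (Fin n))} {ν₁ ν₂ : Measure G} [IsProbabilityMeasure ν₁]
  [IsProbabilityMeasure ν₂] {p : G → G → ℝ}

lemma IsTransport.mem_couplings
    (hp : IsTransport p (fun x => ν₁.real {x}) fun x => ν₂.real {x}) :
    ν₁ ⊗ₘ matrixKernel p ∈ couplings ν₁ ν₂ := by
  have := hp.isMarkovKernel
  exact ⟨Measure.fst_compProd _ _, hp.snd_compProd⟩

lemma W₁_le (d : G → G → ℝ≥0∞) (hp : IsTransport p (fun x => ν₁.real {x}) fun x => ν₂.real {x}) :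
    W₁ d ν₁ ν₂ ≤ ∑ σ, (∑ τ, ENNReal.ofReal (p σ τ) * d σ τ) * ν₁ {σ} := by
  have := hp.isMarkovKernel
  refine (iInf₂_le _ hp.mem_couplings).trans_eq ?_
  rw [Measure.lintegral_compProd .of_discrete, lintegral_fintype]
  simp only [lintegral_matrixKernel]

lemma Ttilde_le (d : G → G → ℝ≥0∞)
    (hp : IsTransport p (fun x => ν₁.real {x}) fun x => ν₂.real {x}) :
    Ttilde d ν₂ ν₁ ≤ ∑ σ, (∑ τ, ENNReal.ofReal (p σ τ) * d σ τ) ^ 2 * ν₁ {σ} := by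
  refine (iInf₂_le _ hp.mem_couplings).trans ((iInf₂_le _ hp.isMarkovKernel).trans
    ((iInf_le _ rfl).trans_eq ?_))
  rw [lintegral_fintype]
  simp only [lintegral_matrixKernel]

lemma That_le (hp : IsTransport p (fun x => ν₁.real {x}) fun x => ν₂.real {x}) :
    That ν₂ ν₁ ≤ ENNReal.ofReal (∑ σ, ν₁.real {σ} * ∑ l, applyMove p σ l ^ 2) := by
  refine (iInf₂_le _ hp.mem_couplings).trans ((iInf₂_le _ hp.isMarkovKernel).trans
    ((iInf_le _ rfl).trans_eq ?_))
  rw [lintegral_fintype, ENNReal.ofReal_sum_of_nonneg fun σ _ => mul_nonneg measureReal_nonneg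
    (sum_nonneg fun l _ => sq_nonneg _)]
  refine sum_congr rfl fun σ _ => ?_
  rw [ENNReal.ofReal_mul measureReal_nonneg, ofReal_measureReal, mul_comm,
    ENNReal.ofReal_sum_of_nonneg fun l _ => sq_nonneg _]
  congr 1
  refine sum_congr rfl fun l _ => ?_
  have h0 : 0 ≤ applyMove p σ l := sum_ite_nonneg (hp.1 σ) _
  rw [matrixKernel_apply_setOf (hp.1 σ).1, ENNReal.ofReal_pow h0, applyMove]
  simp only [ne_comm]

lemma sq_sum_le_numNontrivialOrb_mul {f : Fin n → ℝ} (hf : ∀ k, f k ≠ 0 → orb G k ≠ {k}) :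
    (∑ k, f k) ^ 2 ≤ numNontrivialOrb G * ∑ k, f k ^ 2 := by
  classical
  have hsub : ∀ g : Fin n → ℝ, (∀ k, g k ≠ 0 → orb G k ≠ {k}) →
      ∑ k ∈ univ.filter (fun k => orb G k ≠ {k}), g k = ∑ k, g k :=
    fun g hg => sum_subset (subset_univ _) fun k _ hk => by
      by_contra h
      exact hk (by simpa using hg k h)
  have hcard : numNontrivialOrb G = (univ.filter (fun k => orb G k ≠ {k})).card := by
    rw [numNontrivialOrb, ← Set.ncard_coe_finset]
    simp
  rw [hcard, ← hsub f hf, ← hsub (fun k => f k ^ 2) fun k hk => hf k (by simpa using hk)]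
  exact sq_sum_le_card_mul_sum_sq

/-- If all orbits are trivial, the values are located one after the other from the top, and any two
elements agree. -/
lemma subsingleton_of_numNontrivialOrb (h : numNontrivialOrb G = 0) : Subsingleton G := by
  have h' : ∀ j, orb G j = {j} := by
    rw [numNontrivialOrb, Set.ncard_eq_zero (Set.toFinite _), Set.eq_empty_iff_forall_notMem] at h
    simpa using h
  refine ⟨fun σ τ => eq_of_agree (J := univ) (fun k => mem_univ k) fun k _ => ?_⟩
  induction k using WellFoundedGT.induction with
  | ind k ih => exact pos_eq_of_orb_eq (h' k) fun l hl => ih l (by simpa using hl) (mem_univ l)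

end Cost

/-! ### The transport-entropy inequalities from shifts. -/

section Inequalities

variable {n : ℕ} {G : Subgroup (Equiv.Perm (Fin n))} {μ : Measure G} [IsProbabilityMeasure μ]

lemma entropyBound_eq_top {μ ν₁ ν₂ : Measure G} (h : ¬ (ν₁ ≪ μ ∧ ν₂ ≪ μ)) :
    entropyBound μ ν₁ ν₂ = ∞ := by
  rw [not_and_or] at h
  rw [entropyBound]
  rcases h with h | h <;> rw [klDiv_of_not_ac h, ENNReal.top_rpow_of_pos (by norm_num)] <;> simp

lemma absolutelyContinuous_of_subsingleton [Subsingleton G] (ν : Measure G) : ν ≪ μ := by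
  intro A hA
  rcases A.eq_empty_or_nonempty with rfl | hne
  · exact measure_empty
  · rw [Subsingleton.eq_univ_of_nonempty hne, measure_univ] at hA
    exact absurd hA one_ne_zero

/-- When an entropy is infinite the bound is trivial unless `K = 0`, where `0 * ∞ = 0`; in that case
the group is trivial and absolute continuity cannot fail. -/
lemma le_mul_entropyBound {T : ℝ≥0∞} {K : ℕ} {ν₁ ν₂ : Measure G} [IsProbabilityMeasure ν₁]
    [IsProbabilityMeasure ν₂] (hK : K = 0 → Subsingleton G)
    (h : ν₁ ≪ μ → ν₂ ≪ μ → ∀ a b : ℝ, 0 < a → 0 < b → 1 / a + 1 / b = 1 →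
      T ≤ K * ENNReal.ofReal (a * relEnt (fun σ => ν₁.real {σ}) (fun σ => μ.real {σ}) +
        b * relEnt (fun σ => ν₂.real {σ}) fun σ => μ.real {σ})) :
    T ≤ K * entropyBound μ ν₁ ν₂ := by
  by_cases hac : ν₁ ≪ μ ∧ ν₂ ≪ μ
  · rw [entropyBound, klDiv_eq_ofReal_relEnt hac.1, klDiv_eq_ofReal_relEnt hac.2]
    exact le_mul_sqrt_add_sqrt_sq (ENNReal.natCast_ne_top K)
      (relEnt_nonneg (isProb_real ν₁) (isProb_real μ).1 (real_ne_zero_of_ac hac.1))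
      (relEnt_nonneg (isProb_real ν₂) (isProb_real μ).1 (real_ne_zero_of_ac hac.2))
      (h hac.1 hac.2)
  · have hK0 : (K : ℝ≥0∞) ≠ 0 := by
      intro h0
      have := hK (by exact_mod_cast h0)
      exact hac ⟨absolutelyContinuous_of_subsingleton ν₁, absolutelyContinuous_of_subsingleton ν₂⟩
    rw [entropyBound_eq_top hac, ENNReal.mul_top hK0]
    exact le_top

/-- Shifts of cost at most `c` along the chain of the `G_j` give the transport-entropy inequalities
with the constant `c`. -/
theorem entropyIneq_of_swap {d : G → G → ℝ≥0∞} (hd : ∀ σ, d σ σ = 0)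
    (htri : ∀ σ τ ρ, d σ ρ ≤ d σ τ + d τ ρ) {c : ℕ}
    (hS : ∀ j, Swap (fun θ => ∀ σ, d σ (σ * θ) ≤ c) (fun σ => μ.real {σ})
      (univ.filter (j < ·)) j) :
    W₁EntropyIneq d c μ ∧ TtildeEntropyIneq d c μ := by
  have key : ∀ ν₁ ν₂ : Measure G, IsProbabilityMeasure ν₁ → IsProbabilityMeasure ν₂ → ν₁ ≪ μ →
      ν₂ ≪ μ → ∀ a b : ℝ, 0 < a → 0 < b → 1 / a + 1 / b = 1 →
      ∃ E, E = a * relEnt (fun σ => ν₁.real {σ}) (fun σ => μ.real {σ}) +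
        b * relEnt (fun σ => ν₂.real {σ}) (fun σ => μ.real {σ}) ∧
      W₁ d ν₁ ν₂ ^ 2 ≤ c ^ 2 * ENNReal.ofReal (numNontrivialOrb G * (E / 2)) ∧
      Ttilde d ν₂ ν₁ ≤ c ^ 2 * ENNReal.ofReal (numNontrivialOrb G * (2 * E)) := by
    intro ν₁ ν₂ h₁ h₂ hac₁ hac₂ a b ha hb hab
    refine ⟨_, rfl, ?_⟩
    -- The chain starts at level `n`, where no position is prescribed.
    have hr : restr (fun σ : G => μ.real {σ}) (univ.filter (n ≤ ·.val)) 1 =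
        fun σ => μ.real {σ} := by
      have he : (univ.filter (fun k : Fin n => n ≤ k.val)) = ∅ :=
        filter_eq_empty_iff.2 fun k _ => not_le.2 k.isLt
      funext σ
      simp [restr, Agree, he]
    obtain ⟨p, V, hp, hV, hVorb, hcost, hE₂, hE₁⟩ := exists_transport_of_chain ha hb hab hd htri
      (isProb_real μ).1 hS n le_rfl 1 _ _ (isProb_real ν₁) (isProb_real ν₂)
      (by rw [hr]; exact real_ne_zero_of_ac hac₁) (by rw [hr]; exact real_ne_zero_of_ac hac₂)
    rw [hr] at hE₁ hE₂
    set E := a * relEnt (fun σ => ν₁.real {σ}) (fun σ => μ.real {σ}) +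
        b * relEnt (fun σ => ν₂.real {σ}) (fun σ => μ.real {σ})
    have hsum : ∀ σ, 0 ≤ ∑ k, V σ k := fun σ => sum_nonneg fun k _ => hV σ k
    have hcost' : ∀ σ, ν₁ {σ} ≠ 0 →
        ∑ τ, ENNReal.ofReal (p σ τ) * d σ τ ≤ c * ENNReal.ofReal (∑ k, V σ k) := fun σ hσ =>
      hcost σ ((measureReal_ne_zero_iff).2 hσ)
    constructor
    · have hW : W₁ d ν₁ ν₂ ≤ c * ENNReal.ofReal (∑ k, ∑ σ, ν₁.real {σ} * V σ k) := by
        refine (W₁_le d hp).trans ?_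
        rw [sum_comm, ENNReal.ofReal_sum_of_nonneg fun σ _ => sum_nonneg fun k _ =>
          mul_nonneg measureReal_nonneg (hV σ k), mul_sum]
        refine sum_le_sum fun σ _ => ?_
        rw [← mul_sum, ENNReal.ofReal_mul measureReal_nonneg, ofReal_measureReal, mul_comm (ν₁ {σ}),
          ← mul_assoc]
        by_cases hσ : ν₁ {σ} = 0
        · simp [hσ]
        · gcongr
          exact hcost' σ hσ
      refine (pow_le_pow_left' hW 2).trans ?_
      rw [mul_pow, ← ENNReal.ofReal_pow (sum_nonneg fun k _ => sum_nonneg fun σ _ =>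
        mul_nonneg measureReal_nonneg (hV σ k))]
      gcongr
      refine (sq_sum_le_numNontrivialOrb_mul (G := G) fun k hk => ?_).trans
        (mul_le_mul_of_nonneg_left hE₁ (Nat.cast_nonneg _))
      obtain ⟨σ, -, hσ⟩ := exists_ne_zero_of_sum_ne_zero hk
      exact (hVorb σ k (right_ne_zero_of_mul hσ)).2
    · have hT : Ttilde d ν₂ ν₁ ≤
          c ^ 2 * ENNReal.ofReal (∑ σ, ν₁.real {σ} * (∑ k, V σ k) ^ 2) := by
        refine (Ttilde_le d hp).trans ?_
        rw [ENNReal.ofReal_sum_of_nonneg fun σ _ => mul_nonneg measureReal_nonneg (sq_nonneg _),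
          mul_sum]
        refine sum_le_sum fun σ _ => ?_
        rw [ENNReal.ofReal_mul measureReal_nonneg, ofReal_measureReal, mul_comm (ν₁ {σ}),
          ← mul_assoc, ENNReal.ofReal_pow (hsum σ), ← mul_pow]
        by_cases hσ : ν₁ {σ} = 0
        · simp [hσ]
        · gcongr
          exact hcost' σ hσ
      refine hT.trans ?_
      gcongr
      calc ∑ σ, ν₁.real {σ} * (∑ k, V σ k) ^ 2
          ≤ ∑ σ, ν₁.real {σ} * (numNontrivialOrb G * ∑ k, V σ k ^ 2) :=
            sum_le_sum fun σ _ => mul_le_mul_of_nonneg_left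
              (sq_sum_le_numNontrivialOrb_mul fun k hk => (hVorb σ k hk).2) measureReal_nonneg
        _ = numNontrivialOrb G * ∑ σ, ν₁.real {σ} * ∑ k, V σ k ^ 2 := by
            rw [mul_sum]
            exact sum_congr rfl fun σ _ => mul_left_comm _ _ _
        _ ≤ _ := mul_le_mul_of_nonneg_left hE₂ (Nat.cast_nonneg _)
  -- Only an inequality, since `c = 0` is possible: for `n = 0` the constant `min (2 * ℓ - 1) n`
  -- vanishes.
  have hcancel : ((c : ℝ≥0∞) ^ 2)⁻¹ * c ^ 2 ≤ 1 := ENNReal.inv_mul_le_one _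
  constructor
  · intro ν₁ ν₂ h₁ h₂
    refine le_mul_entropyBound subsingleton_of_numNontrivialOrb fun hac₁ hac₂ a b ha hb hab => ?_
    obtain ⟨E, rfl, hW, -⟩ := key ν₁ ν₂ h₁ h₂ hac₁ hac₂ a b ha hb hab
    set E := a * relEnt (fun σ => ν₁.real {σ}) (fun σ => μ.real {σ}) +
        b * relEnt (fun σ => ν₂.real {σ}) (fun σ => μ.real {σ})
    calc 2 / (c : ℝ≥0∞) ^ 2 * W₁ d ν₁ ν₂ ^ 2
        ≤ 2 / (c : ℝ≥0∞) ^ 2 * (c ^ 2 * ENNReal.ofReal (numNontrivialOrb G * (E / 2))) := by gcongr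
      _ = ((c : ℝ≥0∞) ^ 2)⁻¹ * c ^ 2 * (2 * ENNReal.ofReal (numNontrivialOrb G * (E / 2))) := by
          rw [ENNReal.div_eq_inv_mul]
          ring
      _ ≤ 1 * (2 * ENNReal.ofReal (numNontrivialOrb G * (E / 2))) := by gcongr
      _ = _ := by
          rw [one_mul, show (2 : ℝ≥0∞) = ENNReal.ofReal 2 by simp, ← ENNReal.ofReal_mul zero_le_two,
            ← ENNReal.ofReal_natCast, ← ENNReal.ofReal_mul (Nat.cast_nonneg _)]
          congr 1
          ring
  · intro ν₁ ν₂ h₁ h₂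
    refine le_mul_entropyBound subsingleton_of_numNontrivialOrb fun hac₁ hac₂ a b ha hb hab => ?_
    obtain ⟨E, rfl, -, hT⟩ := key ν₁ ν₂ h₁ h₂ hac₁ hac₂ a b ha hb hab
    set E := a * relEnt (fun σ => ν₁.real {σ}) (fun σ => μ.real {σ}) +
        b * relEnt (fun σ => ν₂.real {σ}) (fun σ => μ.real {σ})
    calc 1 / (2 * (c : ℝ≥0∞) ^ 2) * Ttilde d ν₂ ν₁
        ≤ 1 / (2 * (c : ℝ≥0∞) ^ 2) *
          (c ^ 2 * ENNReal.ofReal (numNontrivialOrb G * (2 * E))) := by gcongr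
      _ = ((c : ℝ≥0∞) ^ 2)⁻¹ * c ^ 2 *
          (2⁻¹ * ENNReal.ofReal (numNontrivialOrb G * (2 * E))) := by
          rw [one_div, ENNReal.mul_inv (Or.inl two_ne_zero) (Or.inl ENNReal.ofNat_ne_top)]
          ring
      _ ≤ 1 * (2⁻¹ * ENNReal.ofReal (numNontrivialOrb G * (2 * E))) := by gcongr
      _ = _ := by
          rw [one_mul, show (2⁻¹ : ℝ≥0∞) = ENNReal.ofReal 2⁻¹ by
            rw [ENNReal.ofReal_inv_of_pos two_pos]; simp, ← ENNReal.ofReal_mul (by norm_num),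
            ← ENNReal.ofReal_natCast, ← ENNReal.ofReal_mul (Nat.cast_nonneg _)]
          congr 1
          ring

/-- Shifts of degree at most `s + 1` in all fibres, for `μ` and its image under inversion, give the
inequality for the sum over the positions. -/
theorem thatEntropyIneq_of_swap {s : ℕ}
    (hS : ∀ J j, j ∉ J →
      Swap (fun θ : G => deg (θ : Equiv.Perm (Fin n)) ≤ s + 1) (fun σ => μ.real {σ}) J j)
    (hinv : ∀ σ : G, μ.real {σ⁻¹} = μ.real {σ}) : ThatEntropyIneq (2 * s ^ 2 + 2) μ := by
  intro ν₁ ν₂ h₁ h₂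
  rw [show entropyBound μ ν₁ ν₂ = (1 : ℕ) * entropyBound μ ν₁ ν₂ by simp]
  refine le_mul_entropyBound (by simp) fun hac₁ hac₂ a b ha hb hab => ?_
  obtain ⟨p, hp, hp'⟩ := exists_transport_apply ha hb hab (isProb_real μ).1 hS
    (by simpa only [hinv] using hS) (isProb_real ν₁) (isProb_real ν₂) (real_ne_zero_of_ac hac₁)
    (real_ne_zero_of_ac hac₂)
  set E := a * relEnt (fun σ => ν₁.real {σ}) (fun σ => μ.real {σ}) +
    b * relEnt (fun σ => ν₂.real {σ}) (fun σ => μ.real {σ})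
  have hcast : 2 * ((2 * s ^ 2 + 2 : ℕ) : ℝ≥0∞) = ENNReal.ofReal (4 * s ^ 2 + 4) := by
    have : (4 * s ^ 2 + 4 : ℝ) = ((2 * (2 * s ^ 2 + 2) : ℕ) : ℝ) := by
      push_cast
      ring
    rw [this, ENNReal.ofReal_natCast]
    push_cast
    rfl
  calc 1 / (2 * ((2 * s ^ 2 + 2 : ℕ) : ℝ≥0∞)) * That ν₂ ν₁
      ≤ 1 / (2 * ((2 * s ^ 2 + 2 : ℕ) : ℝ≥0∞)) * ENNReal.ofReal ((4 * s ^ 2 + 4) * E) := by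
        gcongr
        exact (That_le hp).trans (ENNReal.ofReal_le_ofReal hp')
    _ = (1 : ℕ) * ENNReal.ofReal E := by
        have hpos : (0 : ℝ) < 4 * s ^ 2 + 4 := by positivity
        rw [hcast, ENNReal.ofReal_mul hpos.le, one_div, ← mul_assoc,
          ENNReal.inv_mul_cancel (by simpa using hpos) ENNReal.ofReal_ne_top, Nat.cast_one]

end Inequalities

/-! ### The two distances under right translation. -/

section Distances

variable {n : ℕ} {G : Subgroup (Equiv.Perm (Fin n))}

lemma dH_self (σ : G) : dH G σ σ = 0 := by simp [dH]

lemma dH_triangle (σ τ ρ : G) : dH G σ ρ ≤ dH G σ τ + dH G τ ρ := by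
  rw [dH, dH, dH]
  exact_mod_cast hammingDist_triangle _ _ _

lemma dH_mul_right (σ θ : G) : dH G σ (σ * θ) = deg (θ : Equiv.Perm (Fin n)) := by
  rw [dH, deg, hammingDist]
  congr 2
  ext k
  simp [eq_comm]

lemma deg_le_card (σ : Equiv.Perm (Fin n)) : deg σ ≤ n := by
  simpa [deg] using card_le_univ σ.support

lemma dT_mul_prod_le {ℓ : ℕ} (σ : G) {l : List G}
    (hl : ∀ t ∈ l, deg (t : Equiv.Perm (Fin n)) ≤ ℓ) : dT ℓ G σ (σ * l.prod) ≤ l.length :=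
  (iInf₂_le l hl).trans (iInf_le _ rfl)

lemma dT_self (ℓ : ℕ) (σ : G) : dT ℓ G σ σ = 0 := by
  have := dT_mul_prod_le (ℓ := ℓ) σ (l := []) (by simp)
  simpa using this

lemma dT_triangle (ℓ : ℕ) (σ τ ρ : G) : dT ℓ G σ ρ ≤ dT ℓ G σ τ + dT ℓ G τ ρ := by
  conv_rhs => rw [dT, dT]
  simp only [ENNReal.iInf_add, ENNReal.add_iInf, le_iInf_iff]
  rintro l' hl' rfl l hl rfl
  -- Concatenated factorizations add their lengths.
  have := dT_mul_prod_le σ (l := l ++ l') fun t ht => (List.mem_append.1 ht).elim (hl t) (hl' t)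
  simpa [mul_assoc] using this

end Distances

instance isProbabilityMeasure_uniformLaw {n : ℕ} (G : Subgroup (Equiv.Perm (Fin n))) :
    IsProbabilityMeasure (uniformLaw G) :=
  isProbabilityMeasure_uniformOn Set.finite_univ Set.univ_nonempty

lemma real_uniformLaw {n : ℕ} {G : Subgroup (Equiv.Perm (Fin n))} (σ τ : G) :
    (uniformLaw G).real {σ} = (uniformLaw G).real {τ} := by
  simp [measureReal_def, uniformLaw, uniformOn_univ]

lemma isProbabilityMeasure_of_mem_measureClass {n : ℕ} {G : Subgroup (Equiv.Perm (Fin n))}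
    {t : (j : Fin n) → orb G j → G} {μ : Measure G} (hμ : μ ∈ measureClass t) :
    IsProbabilityMeasure μ := by
  obtain ⟨ν, hν, rfl⟩ := hμ
  exact Measure.isProbabilityMeasure_map Measurable.of_discrete.aemeasurable

end PermTransport

end

open PermTransport MeasureTheory in
theorem theorem1p3 {n ℓ : ℕ} (hℓ : 2 ≤ ℓ) (G : Subgroup (Equiv.Perm (Fin n))) :
    -- measures of the class attached to a local base
    (∀ t : (j : Fin n) → PermTransport.orb G j → G, PermTransport.IsLocalBase ℓ G t →
      ∀ μ ∈ PermTransport.measureClass t,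
        PermTransport.W₁EntropyIneq (PermTransport.dH G) (min (2 * ℓ - 1) n) μ ∧
        PermTransport.W₁EntropyIneq (PermTransport.dT ℓ G) 2 μ ∧
        PermTransport.TtildeEntropyIneq (PermTransport.dH G) (min (2 * ℓ - 1) n) μ ∧
        PermTransport.TtildeEntropyIneq (PermTransport.dT ℓ G) 2 μ ∧
        (G.Normal →
          (∀ σ : G, μ {σ} = μ {σ⁻¹}) →
          (∀ (σ τ : G) (s : Equiv.Perm (Fin n)),
            (τ : Equiv.Perm (Fin n)) = s⁻¹ * (σ : Equiv.Perm (Fin n)) * s → μ {σ} = μ {τ}) →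
          PermTransport.ThatEntropyIneq (8 * (ℓ - 1) ^ 2 + 2) μ)) ∧
    -- the uniform law of a local group
    (PermTransport.IsLocal ℓ G →
      PermTransport.W₁EntropyIneq (PermTransport.dH G) ℓ (PermTransport.uniformLaw G) ∧
      PermTransport.W₁EntropyIneq (PermTransport.dT ℓ G) 1 (PermTransport.uniformLaw G) ∧
      PermTransport.TtildeEntropyIneq (PermTransport.dH G) ℓ (PermTransport.uniformLaw G) ∧
      PermTransport.TtildeEntropyIneq (PermTransport.dT ℓ G) 1 (PermTransport.uniformLaw G) ∧
      PermTransport.ThatEntropyIneq (2 * (ℓ - 1) ^ 2 + 2) (PermTransport.uniformLaw G)) := by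
  refine ⟨fun t ht μ hμ => ?_, fun hG => ?_⟩
  · have := isProbabilityMeasure_of_mem_measureClass hμ
    have hS := ht.swap (by lia) hμ
    obtain ⟨h1, h2⟩ := entropyIneq_of_swap (c := min (2 * ℓ - 1) n) dH_self dH_triangle fun j =>
      (hS j).mono fun θ hθ σ => by
        rw [dH_mul_right]
        exact_mod_cast le_min hθ.1 (deg_le_card _)
    obtain ⟨h3, h4⟩ := entropyIneq_of_swap (c := 2) (dT_self ℓ) (dT_triangle ℓ) fun j =>
      (hS j).mono fun θ hθ σ => by
        obtain ⟨-, g₁, g₂, hg₁, hg₂, rfl⟩ := hθ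
        have := dT_mul_prod_le σ (l := [g₁, g₂]) (ℓ := ℓ) (by simp [hg₁, hg₂])
        simpa using this
    refine ⟨h1, h3, h2, h4, fun hN hinv hconj => ?_⟩
    -- Shifts of degree at most `2ℓ - 1 = s + 1` correspond to `s = 2 (ℓ - 1)`; for the uniform law
    -- of a local group the degree is at most `ℓ` and `s = ℓ - 1`.
    have hc : 8 * (ℓ - 1) ^ 2 + 2 = 2 * (2 * (ℓ - 1)) ^ 2 + 2 := by ring
    rw [hc]
    refine thatEntropyIneq_of_swap (fun J j hj => swap_of_conj_invariant hN
      (fun σ τ s h => by rw [measureReal_def, measureReal_def, hconj σ τ s h])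
      (fun j => (hS j).mono fun θ hθ => hθ.1.trans (by lia)) J j hj) fun σ => ?_
    rw [measureReal_def, measureReal_def, hinv σ]
  · have hS : ∀ J j, _ := fun J j => hG.swap (real_uniformLaw (G := G)) J j
    obtain ⟨h1, h2⟩ := entropyIneq_of_swap (c := ℓ) dH_self dH_triangle fun j =>
      (hS _ j).mono fun θ hθ σ => by
        rw [dH_mul_right]
        exact_mod_cast hθ
    obtain ⟨h3, h4⟩ := entropyIneq_of_swap (c := 1) (dT_self ℓ) (dT_triangle ℓ) fun j =>
      (hS _ j).mono fun θ hθ σ => by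
        have := dT_mul_prod_le σ (l := [θ]) (ℓ := ℓ) (by simpa using hθ)
        simpa using this
    exact ⟨h1, h3, h2, h4, thatEntropyIneq_of_swap
      (fun J j _ => (hS J j).mono fun θ hθ => hθ.trans (by lia)) fun σ => real_uniformLaw _ _⟩
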